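/- Let $\pi\colon E\to M$ be a smooth fibre bundle with $\dim M=m$ and $\dim E=m+n$, where $M$ and $E$ are smooth (Hausdorff, second countable) manifolds and $M$ carries a fixed volume form $\eta$. Let $\Lambda^m_2(T^*E)$ (resp. $\Lambda^m_1(T^*E)$) be the bundle of $m$-forms on $E$ that vanish when contracted with any two (resp. any one) $\pi$-vertical vectors, let $J^1\pi^*=\Lambda^m_2(T^*E)/\Lambda^m_1(T^*E)$, with quotient map $\mu\colon\Lambda^m_2(T^*E)\to J^1\pi^*$ and projections $\pi_E\colon\Lambda^m_2(T^*E)\to E$, $\pi^r_E\colon J^1\pi^*\to E$, $\bar\pi^r_E=\pi\circ\pi^r_E\colon J^1\pi^*\to M$. Let $\Theta$ be the tautological $m$-form on $\Lambda^m_2(T^*E)$, $\Theta_\omega(X_1,\dots,X_m)=\omega(T\pi_E X_1,\dots,T\pi_E X_m)$, and $\Omega=-d\Theta$. Let $h$ be a Hamiltonian section, that is, a smooth global section of $\mu$, and put $\Omega_h=h^*\Omega$. Sections of $\pi$ and of $\bar\pi^r_E$ are understood to be smooth local sections, over open subsets of $M$. A local section is an integral section of a distribution if at each of its points the tangent space of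 its image equals the distribution. Let $\mathcal D_h$ be a distribution on $J^1\pi^*$ that solves the Hamiltonian problem: it is $m$-dimensional, transverse to the fibres of $\bar\pi^r_E$ and integrable, and each of its integral sections $\psi$ satisfies $\psi^*i(X)\Omega_h=0$ for every vector field $X$ on $J^1\pi^*$. Let $s$ be a smooth global section of $\pi^r_E$, and let $\mathcal D$ be an $m$-dimensional integrable distribution on $E$ that is transverse to the fibres of $\pi$. Denote by $\{\mathcal X\}$ the set of all nowhere vanishing, locally decomposable $m$-vector fields on $E$ that are sections of $\Lambda^m\mathcal D$, and by $\{\mathcal X_h\}$ the corresponding set for $\mathcal D_h$ on $J^1\pi^*$. Then the following are equivalent. 1. (Generalized Hamiltonian Hamilton-Jacobi condition.) For every local section $\gamma$ of $\pi$ that is an integral section of $\mathcal D$, the local section $s\circ\gamma$ of $\bar\pi^r_E$ is an integral section of $\mathcal D_h$. 2. $\mathcal D$ and $\mathcal D_h$ are $s$-related: for every $\mathcal X_h\in\{\mathcal X_h\}$ there exists $\mathcal X\in\{\mathcal X\}$, and for every $\mathcal X\in\{\mathcal X\}$ there exists $\mathcal X_h\in\{\mathcal X_h\}$, such that $\mathcal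 X_h\circ s=\Lambda^mTs\circ\mathcal X$. -/

import Mathlib

open scoped Manifold Topology ContDiff
open Set

namespace HJ

universe u v

/-- The model space with coordinates `(x, u)`. -/
abbrev AdaptedModel (m n : ℕ) : Type := EuclideanSpace ℝ (Fin m) × EuclideanSpace ℝ (Fin n)

section LinearAlgebra

variable {T : Type*} [AddCommGroup T] [Module ℝ T] [TopologicalSpace T]

/-- The `m`-forms on `T` that vanish on any two vectors of `W`, as a subspace of all `m`-forms. -/
def semibasic₂ (m : ℕ) (W : Submodule ℝ T) : Submodule ℝ (T [⋀^Fin m]→L[ℝ] ℝ) where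
  carrier := {ξ | ∀ (v : Fin m → T) (i j : Fin m), i ≠ j → v i ∈ W → v j ∈ W → ξ v = 0}
  add_mem' := fun {a b} ha hb v i j hij hi hj => by
    simp [ha v i j hij hi hj, hb v i j hij hi hj]
  zero_mem' := fun _ _ _ _ _ _ => rfl
  smul_mem' := fun c a ha v i j hij hi hj => by simp [ha v i j hij hi hj]

/-- The vector space of the `m`-forms on `T` that vanish on any two vectors of `W`. -/
def ExtForm (m : ℕ) (W : Submodule ℝ T) : Type _ := semibasic₂ m W

instance (m : ℕ) (W : Submodule ℝ T) : AddCommGroup (ExtForm m W) :=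
  inferInstanceAs (AddCommGroup (semibasic₂ m W))

instance (m : ℕ) (W : Submodule ℝ T) : Module ℝ (ExtForm m W) :=
  inferInstanceAs (Module ℝ (semibasic₂ m W))

/-- The `m`-forms on `T` that vanish on any vector of `W`. -/
def semibasic₁ (m : ℕ) (W : Submodule ℝ T) : Submodule ℝ (ExtForm m W) where
  carrier := {ξ | ∀ (v : Fin m → T) (i : Fin m), v i ∈ W → ξ.1 v = 0}
  add_mem' := fun {a b} ha hb v i hi => by
    change a.1 v + b.1 v = 0
    rw [ha v i hi, hb v i hi, add_zero]
  zero_mem' := fun _ _ _ => rfl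
  smul_mem' := fun c a ha v i hi => by
    change c • a.1 v = 0
    rw [ha v i hi, smul_zero]

/-- The quotient of the forms that vanish on any two vectors of `W` by those that vanish on any
vector of `W`. -/
def RedForm (m : ℕ) (W : Submodule ℝ T) : Type _ := ExtForm m W ⧸ semibasic₁ m W

instance (m : ℕ) (W : Submodule ℝ T) : AddCommGroup (RedForm m W) :=
  inferInstanceAs (AddCommGroup (ExtForm m W ⧸ semibasic₁ m W))

instance (m : ℕ) (W : Submodule ℝ T) : Module ℝ (RedForm m W) :=
  inferInstanceAs (Module ℝ (ExtForm m W ⧸ semibasic₁ m W))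

variable {m n : ℕ}

/-- The quotient map. -/
def RedForm.mk {W : Submodule ℝ T} : ExtForm m W →ₗ[ℝ] RedForm m W := (semibasic₁ m W).mkQ

/-- The coordinate forms and vectors of the model space. -/
noncomputable def dx (i : Fin m) : AdaptedModel m n →L[ℝ] ℝ :=
  (EuclideanSpace.proj i).comp (ContinuousLinearMap.fst ℝ _ _)

noncomputable def du (α : Fin n) : AdaptedModel m n →L[ℝ] ℝ :=
  (EuclideanSpace.proj α).comp (ContinuousLinearMap.snd ℝ _ _)

noncomputable def ddx (i : Fin m) : AdaptedModel m n := (EuclideanSpace.single i 1, 0)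

noncomputable def ddu (α : Fin n) : AdaptedModel m n := (0, EuclideanSpace.single α 1)

@[simp] theorem dx_ddx (i j : Fin m) : dx i (ddx j : AdaptedModel m n) = if i = j then 1 else 0 := by
  simp [dx, ddx]
@[simp] theorem dx_ddu (i : Fin m) (α : Fin n) : dx i (ddu α : AdaptedModel m n) = 0 := by
  simp [dx, ddu]
@[simp] theorem du_ddx (i : Fin m) (α : Fin n) : du α (ddx i : AdaptedModel m n) = 0 := by
  simp [du, ddx]
@[simp] theorem du_ddu (α β : Fin n) : du α (ddu β : AdaptedModel m n) = if α = β then 1 else 0 := by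
  simp [du, ddu]

/-- The `m`-form `θ ↦ θ 0 ∧ … ∧ θ (m - 1)`, that is, `v ↦ det (θ i (v j))`. -/
noncomputable def wedgeCovectors (θ : Fin m → T →L[ℝ] ℝ) : T [⋀^Fin m]→L[ℝ] ℝ where
  toAlternatingMap := Matrix.detRowAlternating.compLinearMap
    (LinearMap.pi fun i => (θ i : T →ₗ[ℝ] ℝ))
  cont := by
    refine Continuous.matrix_det (continuous_matrix fun j i => ?_)
    exact (θ i).continuous.comp (continuous_apply j)

theorem wedgeCovectors_apply (θ : Fin m → T →L[ℝ] ℝ) (v : Fin m → T) :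
    wedgeCovectors θ v = Matrix.det (Matrix.of fun j i => θ i (v j)) := rfl

/-- Coordinates `(p, p i α)` of an `m`-form. -/
noncomputable def formCoord : (AdaptedModel m n [⋀^Fin m]→L[ℝ] ℝ) →ₗ[ℝ] ℝ × (Fin m → Fin n → ℝ) where
  toFun ξ := (ξ ddx, fun i α => ξ (Function.update ddx i (ddu α)))
  map_add' _ _ := rfl
  map_smul' _ _ := rfl

/-- `p dᵐx + p i α du α ∧ dᵐ⁻¹x i`. -/
noncomputable def coordForm :
    ℝ × (Fin m → Fin n → ℝ) →ₗ[ℝ] (AdaptedModel m n [⋀^Fin m]→L[ℝ] ℝ) where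
  toFun q := q.1 • wedgeCovectors dx +
    ∑ i, ∑ α, q.2 i α • wedgeCovectors (Function.update dx i (du α))
  map_add' q r := by
    simp [add_smul, Finset.sum_add_distrib]; abel
  map_smul' c q := by
    simp [Finset.smul_sum, smul_smul]

abbrev verticalModel (m n : ℕ) : Submodule ℝ (AdaptedModel m n) :=
  LinearMap.ker (LinearMap.fst ℝ (EuclideanSpace ℝ (Fin m)) (EuclideanSpace ℝ (Fin n)))

theorem dx_of_mem {v : AdaptedModel m n} (h : v ∈ verticalModel m n) (i : Fin m) : dx i v = 0 := by
  have : v.1 = 0 := h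
  simp [dx, this]

theorem ddu_mem (α : Fin n) : (ddu α : AdaptedModel m n) ∈ verticalModel m n := by
  simp [ddu]

theorem coordForm_mem (q : ℝ × (Fin m → Fin n → ℝ)) :
    coordForm q ∈ semibasic₂ m (verticalModel m n) := by
  have key : ∀ (θ : Fin m → AdaptedModel m n →L[ℝ] ℝ) (v : Fin m → AdaptedModel m n) (a b : Fin m)
      (k : Fin m), a ≠ b → (∀ i, i ≠ k → θ i (v a) = 0) → (∀ i, i ≠ k → θ i (v b) = 0) →
      wedgeCovectors θ v = 0 := by
    intro θ v a b k hab ha hb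
    rw [wedgeCovectors_apply]
    by_cases h0 : θ k (v a) = 0
    · refine Matrix.det_eq_zero_of_row_eq_zero a fun i => ?_
      by_cases hi : i = k
      · subst hi; exact h0
      · exact ha i hi
    · have h1 := Matrix.det_updateRow_add_smul_self (Matrix.of fun j i => θ i (v j)) hab.symm
        (-(θ k (v b)) / θ k (v a))
      rw [← h1]
      refine Matrix.det_eq_zero_of_row_eq_zero b fun i => ?_
      rw [Matrix.updateRow_self]
      by_cases hi : i = k
      · subst hi; simp; field_simp; ring
      · simp [ha i hi, hb i hi]
  intro v a b hab ha hb
  have h1 : wedgeCovectors (dx : Fin m → AdaptedModel m n →L[ℝ] ℝ) v = 0 :=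
    key _ v a b a hab (fun i _ => dx_of_mem ha i) (fun i _ => dx_of_mem hb i)
  have h2 : ∀ i α, wedgeCovectors (Function.update (dx : Fin m → AdaptedModel m n →L[ℝ] ℝ) i (du α)) v = 0 := by
    intro i α
    refine key _ v a b i hab (fun k hk => ?_) (fun k hk => ?_) <;>
      rw [Function.update_of_ne hk]
    · exact dx_of_mem ha k
    · exact dx_of_mem hb k
  simp [coordForm, ContinuousAlternatingMap.sum_apply, h1, h2]

theorem formCoord_coordForm (q : ℝ × (Fin m → Fin n → ℝ)) : formCoord (coordForm q) = q := by
  have h11 : wedgeCovectors (dx : Fin m → AdaptedModel m n →L[ℝ] ℝ) ddx = 1 := by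
    rw [wedgeCovectors_apply]
    convert Matrix.det_one (n := Fin m) (R := ℝ)
    ext j i
    simp [Matrix.one_apply, eq_comm]
  have h12 : ∀ i (α : Fin n), wedgeCovectors (Function.update (dx : Fin m → AdaptedModel m n →L[ℝ] ℝ) i (du α)) ddx = 0 := by
    intro i α
    rw [wedgeCovectors_apply]
    refine Matrix.det_eq_zero_of_column_eq_zero i fun j => ?_
    simp
  have h21 : ∀ i (α : Fin n), wedgeCovectors (dx : Fin m → AdaptedModel m n →L[ℝ] ℝ) (Function.update ddx i (ddu α)) = 0 := by
    intro i α
    rw [wedgeCovectors_apply]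
    refine Matrix.det_eq_zero_of_row_eq_zero i fun j => ?_
    simp
  have h22 : ∀ k (β : Fin n) i (α : Fin n), wedgeCovectors (Function.update (dx : Fin m → AdaptedModel m n →L[ℝ] ℝ) k (du β))
      (Function.update ddx i (ddu α)) = if k = i ∧ β = α then 1 else 0 := by
    intro k β i α
    rw [wedgeCovectors_apply]
    by_cases hk : k = i
    · subst hk
      rw [← Matrix.det_transpose]
      have : (Matrix.of fun j i => (Function.update (dx : Fin m → AdaptedModel m n →L[ℝ] ℝ) k (du β)) i
          ((Function.update ddx k (ddu α) : Fin m → AdaptedModel m n) j)).transpose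
          = Matrix.diagonal (fun j => if j = k then (if β = α then 1 else 0) else 1) := by
        ext a b
        simp only [Matrix.transpose_apply, Matrix.of_apply, Matrix.diagonal_apply]
        by_cases ha : a = k <;> by_cases hb : b = k
        · subst ha; subst hb; simp
        · subst ha; simp [Function.update_of_ne hb, Ne.symm hb]
        · subst hb; simp [ha]
        · simp [Function.update_of_ne hb, ha]
      rw [this, Matrix.det_diagonal, Finset.prod_ite_eq' ]
      simp
    · rw [if_neg (fun h => hk h.1)]
      refine Matrix.det_eq_zero_of_column_eq_zero i fun j => ?_
      rw [Matrix.of_apply, Function.update_of_ne (Ne.symm hk)]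
      by_cases hj : j = i
      · subst hj; simp
      · simp [Function.update_of_ne hj, Ne.symm hj]
  ext
  · simp [formCoord, coordForm, ContinuousAlternatingMap.sum_apply, h11, h12]
  · rename_i i α
    simp [formCoord, coordForm, ContinuousAlternatingMap.sum_apply, h21, h22, ite_and]

theorem eq_zero_of_formCoord_eq_zero {ξ : AdaptedModel m n [⋀^Fin m]→L[ℝ] ℝ}
    (hξ : ξ ∈ semibasic₂ m (verticalModel m n)) (h : formCoord ξ = 0) : ξ = 0 := by
  classical
  have h0 : ξ ddx = 0 := congrArg Prod.fst h
  have h1 : ∀ i α, ξ (Function.update ddx i (ddu α)) = 0 := fun i α =>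
    congrFun (congrFun (congrArg Prod.snd h) i) α
  let b : Module.Basis (Fin m ⊕ Fin n) ℝ (AdaptedModel m n) :=
    (EuclideanSpace.basisFun (Fin m) ℝ).toBasis.prod (EuclideanSpace.basisFun (Fin n) ℝ).toBasis
  have bl : ∀ i, b (Sum.inl i) = ddx i := fun i => by simp [b, ddx]
  have br : ∀ α, b (Sum.inr α) = ddu α := fun α => by simp [b, ddu]
  have hperm : ∀ (w : Fin m → AdaptedModel m n) (σ : Equiv.Perm (Fin m)), ξ w = 0 →
      ξ (fun k => w (σ k)) = 0 := by
    intro w σ hw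
    have := ξ.toAlternatingMap.map_perm w σ
    have h2 : ξ (w ∘ σ) = Equiv.Perm.sign σ • ξ w := this
    rw [hw, smul_zero] at h2
    exact h2
  apply ContinuousAlternatingMap.toAlternatingMap_injective
  refine Module.Basis.ext_alternating b fun v hv => ?_
  change ξ (fun i => b (v i)) = 0
  by_cases hall : ∀ k, ∃ i, v k = Sum.inl i
  · choose σ hσ using hall
    have hinj : Function.Injective σ := fun a c hac => hv (by rw [hσ, hσ, hac])
    have := hperm ddx (Equiv.ofBijective σ (Finite.injective_iff_bijective.1 hinj)) h0
    convert this using 2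
    ext1 k
    rw [hσ, bl]; rfl
  · push Not at hall
    obtain ⟨j, hj⟩ := hall
    obtain ⟨α, hα⟩ : ∃ α, v j = Sum.inr α := by
      cases hvj : v j with
      | inl i => exact absurd hvj (hj i)
      | inr α => exact ⟨α, rfl⟩
    by_cases hone : ∀ k, k ≠ j → ∃ i, v k = Sum.inl i
    · choose! σ hσ using hone
      have hinj : Set.InjOn σ (↑(Finset.univ.erase j) : Set (Fin m)) := fun a ha c hc hac =>
        hv (by rw [hσ a (by simpa using ha), hσ c (by simpa using hc), hac])
      obtain ⟨i, hi⟩ : ∃ i, i ∉ (Finset.univ.erase j).image σ := by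
        by_contra hcon
        push Not at hcon
        have h3 : ((Finset.univ.erase j).image σ) = Finset.univ :=
          Finset.eq_univ_iff_forall.2 hcon
        have h4 := congrArg Finset.card h3
        rw [Finset.card_image_of_injOn hinj, Finset.card_erase_of_mem (Finset.mem_univ _),
          Finset.card_univ, Fintype.card_fin] at h4
        have := j.pos
        omega
      have hi' : ∀ k, k ≠ j → σ k ≠ i := fun k hk hki =>
        hi (Finset.mem_image.2 ⟨k, by simpa using hk, hki⟩)
      have hτ : Function.Injective (Function.update σ j i) := by
        intro a c hac
        by_cases ha : a = j <;> by_cases hc : c = j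
        · rw [ha, hc]
        · subst ha
          rw [Function.update_self, Function.update_of_ne hc] at hac
          exact absurd hac.symm (hi' c hc)
        · subst hc
          rw [Function.update_self, Function.update_of_ne ha] at hac
          exact absurd hac (hi' a ha)
        · rw [Function.update_of_ne hc, Function.update_of_ne ha] at hac
          exact hinj (by simpa using ha) (by simpa using hc) hac
      have := hperm (Function.update ddx i (ddu α))
        (Equiv.ofBijective _ (Finite.injective_iff_bijective.1 hτ)) (h1 i α)
      convert this using 2
      ext1 k
      rw [Equiv.ofBijective_apply]
      by_cases hk : k = j
      · subst hk
        rw [Function.update_self, Function.update_self, hα, br]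
      · rw [Function.update_of_ne hk, Function.update_of_ne (hi' k hk), hσ k hk, bl]
    · push Not at hone
      obtain ⟨k, hkj, hk⟩ := hone
      obtain ⟨β, hβ⟩ : ∃ β, v k = Sum.inr β := by
        cases hvk : v k with
        | inl i => exact absurd hvk (hk i)
        | inr β => exact ⟨β, rfl⟩
      refine hξ _ k j hkj ?_ ?_
      · rw [hβ, br]; exact ddu_mem β
      · rw [hα, br]; exact ddu_mem α

theorem coordForm_formCoord {ξ : AdaptedModel m n [⋀^Fin m]→L[ℝ] ℝ}
    (hξ : ξ ∈ semibasic₂ m (verticalModel m n)) : coordForm (formCoord ξ) = ξ := by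
  rw [← sub_eq_zero]
  refine eq_zero_of_formCoord_eq_zero (Submodule.sub_mem _ (coordForm_mem _) hξ) ?_
  rw [map_sub, formCoord_coordForm, sub_self]

theorem formCoord_snd_eq_zero_iff {ξ : AdaptedModel m n [⋀^Fin m]→L[ℝ] ℝ}
    (hξ : ξ ∈ semibasic₂ m (verticalModel m n)) :
    (formCoord ξ).2 = 0 ↔ ∀ (v : Fin m → AdaptedModel m n) (i : Fin m),
      v i ∈ verticalModel m n → ξ v = 0 := by
  constructor
  · intro h v i hi
    have h1 : wedgeCovectors (dx : Fin m → AdaptedModel m n →L[ℝ] ℝ) v = 0 := by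
      rw [wedgeCovectors_apply]
      exact Matrix.det_eq_zero_of_row_eq_zero i fun j => dx_of_mem hi j
    rw [← coordForm_formCoord hξ]
    simp [coordForm, h, h1]
  · intro h
    ext i α
    exact h _ i (by rw [Function.update_self]; exact ddu_mem α)

theorem comp_mem_semibasic₂ {T' : Type*} [AddCommGroup T'] [Module ℝ T'] [TopologicalSpace T']
    {W : Submodule ℝ T} {W' : Submodule ℝ T'} (A : T →L[ℝ] T') (hA : ∀ v ∈ W, A v ∈ W')
    {ξ : T' [⋀^Fin m]→L[ℝ] ℝ} (hξ : ξ ∈ semibasic₂ m W') :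
    ξ.compContinuousLinearMap A ∈ semibasic₂ m W :=
  fun v i j hij hi hj => hξ (fun k => A (v k)) i j hij (hA _ hi) (hA _ hj)

/-- The coordinates `(p, p i α)` on the `m`-forms on `T` that vanish on any two vectors of `W`,
given by an isomorphism of `T` with the model that takes `W` to the vertical vectors. -/
noncomputable def extCoordEquiv {W : Submodule ℝ T} (A : T ≃L[ℝ] AdaptedModel m n)
    (hA : ∀ v, v ∈ W ↔ A v ∈ verticalModel m n) :
    ExtForm m W ≃ₗ[ℝ] ℝ × (Fin m → Fin n → ℝ) where
  toFun ξ := formCoord (ξ.1.compContinuousLinearMap (A.symm : AdaptedModel m n →L[ℝ] T))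
  map_add' _ _ := rfl
  map_smul' _ _ := rfl
  invFun q := ⟨(coordForm q).compContinuousLinearMap (A : T →L[ℝ] AdaptedModel m n),
    comp_mem_semibasic₂ _ (fun v hv => (hA v).1 hv) (coordForm_mem q)⟩
  left_inv ξ := by
    apply Subtype.ext
    have h := comp_mem_semibasic₂ (A.symm : AdaptedModel m n →L[ℝ] T)
      (fun v hv => (hA _).2 (by rw [ContinuousLinearEquiv.coe_coe, A.apply_symm_apply]; exact hv)) ξ.2
    change (coordForm (formCoord _)).compContinuousLinearMap _ = _
    rw [coordForm_formCoord h]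
    ext v
    simp [Function.comp_def]
  right_inv q := by
    change formCoord (ContinuousAlternatingMap.compContinuousLinearMap
      ((coordForm q).compContinuousLinearMap _) _) = q
    conv_rhs => rw [← formCoord_coordForm q]
    congr 1
    ext v
    simp [Function.comp_def]

theorem extCoordEquiv_snd_eq_zero_iff {W : Submodule ℝ T} (A : T ≃L[ℝ] AdaptedModel m n)
    (hA : ∀ v, v ∈ W ↔ A v ∈ verticalModel m n) (ξ : ExtForm m W) :
    (extCoordEquiv A hA ξ).2 = 0 ↔ ξ ∈ semibasic₁ m W := by
  have h := comp_mem_semibasic₂ (A.symm : AdaptedModel m n →L[ℝ] T)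
      (fun v hv => (hA _).2 (by rw [ContinuousLinearEquiv.coe_coe, A.apply_symm_apply]; exact hv)) ξ.2
  refine (formCoord_snd_eq_zero_iff h).trans ⟨fun h1 v i hi => ?_, fun h1 v i hi => ?_⟩
  · have := h1 (fun k => A (v k)) i ((hA _).1 hi)
    simpa [Function.comp_def] using this
  · exact h1 (fun k => A.symm (v k)) i ((hA _).2 (by rw [A.apply_symm_apply]; exact hi))

/-- The coordinates `p i α` on the quotient. -/
noncomputable def redCoordEquiv {W : Submodule ℝ T} (A : T ≃L[ℝ] AdaptedModel m n)
    (hA : ∀ v, v ∈ W ↔ A v ∈ verticalModel m n) :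
    RedForm m W ≃ₗ[ℝ] (Fin m → Fin n → ℝ) :=
  (Submodule.quotEquivOfEq _
    (LinearMap.ker (LinearMap.snd ℝ ℝ (Fin m → Fin n → ℝ) ∘ₗ (extCoordEquiv A hA).toLinearMap))
    (by
      ext ξ
      exact (extCoordEquiv_snd_eq_zero_iff A hA ξ).symm)).trans
  (LinearMap.quotKerEquivOfSurjective _ (by
    intro p
    exact ⟨(extCoordEquiv A hA).symm (0, p), by simp⟩))

theorem redCoordEquiv_mk {W : Submodule ℝ T} (A : T ≃L[ℝ] AdaptedModel m n)
    (hA : ∀ v, v ∈ W ↔ A v ∈ verticalModel m n) (ξ : ExtForm m W) :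
    redCoordEquiv A hA (RedForm.mk ξ) = (extCoordEquiv A hA ξ).2 := rfl

theorem redCoordEquiv_symm {W : Submodule ℝ T} (A : T ≃L[ℝ] AdaptedModel m n)
    (hA : ∀ v, v ∈ W ↔ A v ∈ verticalModel m n) (p : Fin m → Fin n → ℝ) :
    (redCoordEquiv A hA).symm p = RedForm.mk ((extCoordEquiv A hA).symm (0, p)) := by
  rw [LinearEquiv.symm_apply_eq, redCoordEquiv_mk, LinearEquiv.apply_symm_apply]

/-- The linear change of the coordinates `(p, p i α)` that a linear map of the model induces. -/
noncomputable def extTransition (B : AdaptedModel m n →L[ℝ] AdaptedModel m n) :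
    (ℝ × (Fin m → Fin n → ℝ)) →L[ℝ] (ℝ × (Fin m → Fin n → ℝ)) :=
  LinearMap.toContinuousLinearMap
    { toFun := fun q => formCoord ((coordForm q).compContinuousLinearMap B)
      map_add' := fun q r => by rw [map_add]; rfl
      map_smul' := fun c q => by rw [map_smul]; rfl }

theorem contDiff_coordForm_apply (q : ℝ × (Fin m → Fin n → ℝ)) (w : Fin m → AdaptedModel m n) :
    ContDiff ℝ ∞ fun B : AdaptedModel m n →L[ℝ] AdaptedModel m n =>
      coordForm q (fun i => B (w i)) := by
  have h : ∀ θ : Fin m → AdaptedModel m n →L[ℝ] ℝ, ContDiff ℝ ∞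
      fun B : AdaptedModel m n →L[ℝ] AdaptedModel m n => wedgeCovectors θ (fun i => B (w i)) := by
    intro θ
    simp only [wedgeCovectors_apply, Matrix.det_apply, Matrix.of_apply]
    refine ContDiff.sum fun σ _ => ContDiff.const_smul _ (contDiff_prod fun i _ => ?_)
    exact (θ _).contDiff.comp (contDiff_id.clm_apply contDiff_const)
  simp only [coordForm, LinearMap.coe_mk, AddHom.coe_mk, ContinuousAlternatingMap.add_apply,
    ContinuousAlternatingMap.sum_apply, ContinuousAlternatingMap.smul_apply]
  exact (ContDiff.const_smul _ (h _)).add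
    (ContDiff.sum fun i _ => ContDiff.sum fun α _ => ContDiff.const_smul _ (h _))

theorem contDiff_extTransition : ContDiff ℝ ∞ (extTransition (m := m) (n := n)) := by
  rw [contDiff_clm_apply_iff]
  intro q
  refine ContDiff.prodMk ?_ (contDiff_pi.2 fun i => contDiff_pi.2 fun α => ?_)
  · exact contDiff_coordForm_apply q ddx
  · exact contDiff_coordForm_apply q (Function.update ddx i (ddu α))

noncomputable def redTransition (B : AdaptedModel m n →L[ℝ] AdaptedModel m n) :
    (Fin m → Fin n → ℝ) →L[ℝ] (Fin m → Fin n → ℝ) :=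
  (ContinuousLinearMap.snd ℝ ℝ (Fin m → Fin n → ℝ)).comp
    ((extTransition B).comp (ContinuousLinearMap.inr ℝ ℝ (Fin m → Fin n → ℝ)))

theorem contDiff_redTransition : ContDiff ℝ ∞ (redTransition (m := m) (n := n)) :=
  contDiff_const.clm_comp (contDiff_extTransition.clm_comp contDiff_const)

theorem extTransition_apply {W : Submodule ℝ T} (A A' : T ≃L[ℝ] AdaptedModel m n)
    (hA : ∀ v, v ∈ W ↔ A v ∈ verticalModel m n) (hA' : ∀ v, v ∈ W ↔ A' v ∈ verticalModel m n)
    (q : ℝ × (Fin m → Fin n → ℝ)) :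
    extTransition ((A : T →L[ℝ] AdaptedModel m n).comp (A'.symm : AdaptedModel m n →L[ℝ] T)) q =
      extCoordEquiv A' hA' ((extCoordEquiv A hA).symm q) := rfl

theorem redTransition_apply {W : Submodule ℝ T} (A A' : T ≃L[ℝ] AdaptedModel m n)
    (hA : ∀ v, v ∈ W ↔ A v ∈ verticalModel m n) (hA' : ∀ v, v ∈ W ↔ A' v ∈ verticalModel m n)
    (p : Fin m → Fin n → ℝ) :
    redTransition ((A : T →L[ℝ] AdaptedModel m n).comp (A'.symm : AdaptedModel m n →L[ℝ] T)) p =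
      redCoordEquiv A' hA' ((redCoordEquiv A hA).symm p) := by
  rw [redCoordEquiv_symm, redCoordEquiv_mk]; rfl

end LinearAlgebra

section FiberBundles

variable {M : Type u} {E : Type v} {m n : ℕ}
  [TopologicalSpace M] [ChartedSpace (EuclideanSpace ℝ (Fin m)) M]
  [TopologicalSpace E] [ChartedSpace (EuclideanSpace ℝ (Fin (m + n))) E]

/-- `π : E → M` is a smooth fibre bundle with `dim M = m` and `dim E = m + n`: it is locally
trivial, with smooth local trivializations and an `n`-dimensional manifold as the fibre. -/
class IsSmoothFiberBundle (m n : ℕ) {M : Type u} {E : Type v}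
    [TopologicalSpace M] [ChartedSpace (EuclideanSpace ℝ (Fin m)) M]
    [TopologicalSpace E] [ChartedSpace (EuclideanSpace ℝ (Fin (m + n))) E]
    (π : E → M) : Prop where
  exists_trivialization : ∃ (F : Type v) (_ : TopologicalSpace F)
    (_ : ChartedSpace (EuclideanSpace ℝ (Fin n)) F), IsManifold (𝓡 n) ∞ F ∧
    ∀ x : M, ∃ t : Bundle.Trivialization F π, x ∈ t.baseSet ∧
      ContMDiffOn (𝓡 (m + n)) ((𝓡 m).prod (𝓡 n)) ∞ t t.source ∧
      ContMDiffOn ((𝓡 m).prod (𝓡 n)) (𝓡 (m + n)) ∞ t.toOpenPartialHomeomorph.symm t.target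

/-- A chart `(x, u)` of `E` that is adapted to `π`: the coordinates `x` come from a chart of `M`. -/
structure AdaptedChart (m n : ℕ) {M : Type u} {E : Type v}
    [TopologicalSpace M] [ChartedSpace (EuclideanSpace ℝ (Fin m)) M]
    [TopologicalSpace E] [ChartedSpace (EuclideanSpace ℝ (Fin (m + n))) E]
    (π : E → M) where
  chart : OpenPartialHomeomorph E (AdaptedModel m n)
  contMDiffOn_chart :
    ContMDiffOn (𝓡 (m + n)) 𝓘(ℝ, AdaptedModel m n) ∞ chart chart.source
  contMDiffOn_symm :
    ContMDiffOn 𝓘(ℝ, AdaptedModel m n) (𝓡 (m + n)) ∞ chart.symm chart.target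
  base : OpenPartialHomeomorph M (EuclideanSpace ℝ (Fin m))
  contMDiffOn_base : ContMDiffOn (𝓡 m) (𝓡 m) ∞ base base.source
  contMDiffOn_base_symm : ContMDiffOn (𝓡 m) (𝓡 m) ∞ base.symm base.target
  mapsTo : ∀ u ∈ chart.source, π u ∈ base.source
  fst_chart : ∀ u ∈ chart.source, (chart u).1 = base (π u)

theorem IsSmoothFiberBundle.contMDiff (π : E → M) [IsSmoothFiberBundle m n π] :
    ContMDiff (𝓡 (m + n)) (𝓡 m) ∞ π := by
  obtain ⟨F, _, _, _, hF⟩ := IsSmoothFiberBundle.exists_trivialization (m := m) (n := n) (π := π)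
  intro u
  obtain ⟨t, hx, ht, -⟩ := hF (π u)
  have hu : u ∈ t.source := t.mem_source.2 hx
  have h1 : ContMDiffAt (𝓡 (m + n)) (𝓡 m) ∞ (fun z => (t z).1) u :=
    (ht.contMDiffAt (t.open_source.mem_nhds hu)).fst
  refine h1.congr_of_eventuallyEq ?_
  filter_upwards [t.open_source.mem_nhds hu] with z hz
  exact (t.coe_fst hz).symm

theorem exists_adaptedChart [IsManifold (𝓡 m) ∞ M]
    (π : E → M) [IsSmoothFiberBundle m n π] (u : E) :
    ∃ e : AdaptedChart m n π, u ∈ e.chart.source := by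
  obtain ⟨F, _, _, _, hF⟩ := IsSmoothFiberBundle.exists_trivialization (m := m) (n := n) (π := π)
  obtain ⟨t, hx, ht, hts⟩ := hF (π u)
  let φ := chartAt (EuclideanSpace ℝ (Fin m)) (π u)
  let ψ := chartAt (EuclideanSpace ℝ (Fin n)) (t u).2
  have hφ : ContMDiffOn (𝓡 m) (𝓡 m) ∞ φ φ.source := contMDiffOn_chart
  have hφs : ContMDiffOn (𝓡 m) (𝓡 m) ∞ φ.symm φ.target := contMDiffOn_chart_symm
  have hψ : ContMDiffOn (𝓡 n) (𝓡 n) ∞ ψ ψ.source := contMDiffOn_chart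
  have hψs : ContMDiffOn (𝓡 n) (𝓡 n) ∞ ψ.symm ψ.target := contMDiffOn_chart_symm
  let c : OpenPartialHomeomorph E (AdaptedModel m n) := t.toOpenPartialHomeomorph.trans (φ.prod ψ)
  have hcs : ∀ z, z ∈ c.source ↔ z ∈ t.source ∧ (t z).1 ∈ φ.source ∧ (t z).2 ∈ ψ.source := by
    intro z
    simp only [c, OpenPartialHomeomorph.trans_source]
    rfl
  have hct : ∀ z, z ∈ c.target ↔ (z.1 ∈ φ.target ∧ z.2 ∈ ψ.target) ∧
      (φ.symm z.1, ψ.symm z.2) ∈ t.target := by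
    intro z
    simp only [c, OpenPartialHomeomorph.trans_target]
    rfl
  refine ⟨⟨c, ?_, ?_, φ, hφ, hφs, ?_, ?_⟩, ?_⟩
  · refine ContMDiffOn.prodMk_space (f := fun z => φ (t z).1) (g := fun z => ψ (t z).2) ?_ ?_
    · exact hφ.comp (contMDiff_fst.comp_contMDiffOn (ht.mono fun z hz => ((hcs z).1 hz).1))
        (fun z hz => ((hcs z).1 hz).2.1)
    · exact hψ.comp (contMDiff_snd.comp_contMDiffOn (ht.mono fun z hz => ((hcs z).1 hz).1))
        (fun z hz => ((hcs z).1 hz).2.2)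
  · have h1 : ContMDiffOn 𝓘(ℝ, AdaptedModel m n) (𝓡 m) ∞
        (fun z : AdaptedModel m n => φ.symm z.1) c.target :=
      hφs.comp (contDiff_fst.contMDiff.contMDiffOn) (fun z hz => ((hct z).1 hz).1.1)
    have h2 : ContMDiffOn 𝓘(ℝ, AdaptedModel m n) (𝓡 n) ∞
        (fun z : AdaptedModel m n => ψ.symm z.2) c.target :=
      hψs.comp (contDiff_snd.contMDiff.contMDiffOn) (fun z hz => ((hct z).1 hz).1.2)
    exact hts.comp (h1.prodMk h2) (fun z hz => ((hct z).1 hz).2)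
  · intro z hz
    have h := (hcs z).1 hz
    rw [← t.coe_fst h.1]; exact h.2.1
  · intro z hz
    have h := (hcs z).1 hz
    change φ (t z).1 = _
    rw [t.coe_fst h.1]
  · rw [hcs]
    have hu : u ∈ t.source := t.mem_source.2 hx
    refine ⟨hu, ?_, mem_chart_source _ _⟩
    rw [t.coe_fst hu]; exact mem_chart_source _ _

/-- The vertical subspace `V_u π` of `T_u E`. -/
noncomputable abbrev vertical (m n : ℕ) {M : Type u} {E : Type v}
    [TopologicalSpace M] [ChartedSpace (EuclideanSpace ℝ (Fin m)) M]
    [TopologicalSpace E] [ChartedSpace (EuclideanSpace ℝ (Fin (m + n))) E]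
    (π : E → M) (u : E) : Submodule ℝ (TangentSpace (𝓡 (m + n)) u) :=
  LinearMap.ker (mfderiv (𝓡 (m + n)) (𝓡 m) π u).toLinearMap

namespace AdaptedChart

variable {π : E → M} 

theorem mdifferentiable (e : AdaptedChart m n π) :
    e.chart.MDifferentiable (𝓡 (m + n)) 𝓘(ℝ, AdaptedModel m n) :=
  ⟨e.contMDiffOn_chart.mdifferentiableOn (by simp), e.contMDiffOn_symm.mdifferentiableOn (by simp)⟩

/-- The isomorphism of `T_u E` with the model space that an adapted chart at `u` gives. -/
noncomputable def tangentEquiv (e : AdaptedChart m n π) (u : E) (hu : u ∈ e.chart.source) :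
    TangentSpace (𝓡 (m + n)) u ≃L[ℝ] AdaptedModel m n :=
  e.mdifferentiable.mfderiv hu

theorem mem_vertical_iff [IsSmoothFiberBundle m n π] (e : AdaptedChart m n π) (u : E)
    (hu : u ∈ e.chart.source) (v : TangentSpace (𝓡 (m + n)) u) :
    v ∈ vertical m n π u ↔ e.tangentEquiv u hu v ∈ verticalModel m n := by
  have hb : e.base.MDifferentiable (𝓡 m) (𝓡 m) :=
    ⟨e.contMDiffOn_base.mdifferentiableOn (by simp),
      e.contMDiffOn_base_symm.mdifferentiableOn (by simp)⟩
  have h1 : HasMFDerivAt (𝓡 (m + n)) 𝓘(ℝ, AdaptedModel m n) e.chart u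
      (mfderiv (𝓡 (m + n)) 𝓘(ℝ, AdaptedModel m n) e.chart u) :=
    (e.mdifferentiable.mdifferentiableAt hu).hasMFDerivAt
  have h2 : HasMFDerivAt (𝓡 (m + n)) (𝓡 m) (fun z => (e.chart z).1) u
      ((ContinuousLinearMap.fst ℝ _ _).comp
        (mfderiv (𝓡 (m + n)) 𝓘(ℝ, AdaptedModel m n) e.chart u)) :=
    HasMFDerivAt.comp u
      (hasFDerivAt_fst (𝕜 := ℝ) (p := e.chart u)).hasMFDerivAt h1
  have h3 : HasMFDerivAt (𝓡 (m + n)) (𝓡 m) (fun z => e.base (π z)) u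
      ((mfderiv (𝓡 m) (𝓡 m) e.base (π u)).comp (mfderiv (𝓡 (m + n)) (𝓡 m) π u)) :=
    HasMFDerivAt.comp u (hb.mdifferentiableAt (e.mapsTo u hu)).hasMFDerivAt
      ((IsSmoothFiberBundle.contMDiff π).mdifferentiable (by simp) u).hasMFDerivAt
  have h4 := h3.congr_of_eventuallyEq (f₁ := fun z => (e.chart z).1) (by
    filter_upwards [e.chart.open_source.mem_nhds hu] with z hz using e.fst_chart z hz)
  have h5 := hasMFDerivAt_unique h2 h4
  have h6 : (e.tangentEquiv u hu v).1 = mfderiv (𝓡 m) (𝓡 m) e.base (π u)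
      (mfderiv (𝓡 (m + n)) (𝓡 m) π u v) := DFunLike.congr_fun h5 v
  change mfderiv (𝓡 (m + n)) (𝓡 m) π u v = 0 ↔ (e.tangentEquiv u hu v).1 = 0
  rw [h6]
  exact (map_eq_zero_iff (mfderiv (𝓡 m) (𝓡 m) e.base (π u))
    (hb.mfderiv_injective (e.mapsTo u hu))).symm

/-- The Jacobian of the change from `e'` to `e`, at the point `u`. -/
noncomputable def jacobian (e e' : AdaptedChart m n π) (u : E) :
    AdaptedModel m n →L[ℝ] AdaptedModel m n :=
  fderiv ℝ (e.chart ∘ e'.chart.symm) (e'.chart u)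

theorem jacobian_eq (e e' : AdaptedChart m n π) (u : E) (hu : u ∈ e.chart.source)
    (hu' : u ∈ e'.chart.source) :
    jacobian e e' u = ((e.tangentEquiv u hu : TangentSpace (𝓡 (m + n)) u →L[ℝ] AdaptedModel m n).comp
      ((e'.tangentEquiv u hu').symm : AdaptedModel m n →L[ℝ] TangentSpace (𝓡 (m + n)) u)) := by
  have h0 : e'.chart.symm (e'.chart u) = u := e'.chart.left_inv hu'
  have h1 := (e'.mdifferentiable.mdifferentiableAt_symm (e'.chart.map_source hu')).hasMFDerivAt
  have h2 : HasMFDerivAt (𝓡 (m + n)) 𝓘(ℝ, AdaptedModel m n) e.chart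
      (e'.chart.symm (e'.chart u)) (mfderiv (𝓡 (m + n)) 𝓘(ℝ, AdaptedModel m n) e.chart u) := by
    rw [h0]
    exact (e.mdifferentiable.mdifferentiableAt hu).hasMFDerivAt
  have h3 : HasMFDerivAt 𝓘(ℝ, AdaptedModel m n) 𝓘(ℝ, AdaptedModel m n) (e.chart ∘ e'.chart.symm)
      (e'.chart u) _ := HasMFDerivAt.comp _ h2 h1
  exact mfderiv_eq_fderiv.symm.trans h3.mfderiv

theorem contMDiffOn_jacobian (e e' : AdaptedChart m n π) :
    ContMDiffOn (𝓡 (m + n)) 𝓘(ℝ, AdaptedModel m n →L[ℝ] AdaptedModel m n) ∞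
      (jacobian e e') (e.chart.source ∩ e'.chart.source) := by
  let S : Set (AdaptedModel m n) := e'.chart.target ∩ e'.chart.symm ⁻¹' e.chart.source
  have hS : IsOpen S := e'.chart.isOpen_inter_preimage_symm e.chart.open_source
  have h1 : ContDiffOn ℝ ∞ (e.chart ∘ e'.chart.symm) S := by
    rw [← contMDiffOn_iff_contDiffOn]
    exact e.contMDiffOn_chart.comp (e'.contMDiffOn_symm.mono inter_subset_left)
      (fun z hz => hz.2)
  have h2 : ContDiffOn ℝ ∞ (fderiv ℝ (e.chart ∘ e'.chart.symm)) S :=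
    h1.fderiv_of_isOpen hS (by simp)
  refine h2.contMDiffOn.comp (e'.contMDiffOn_chart.mono inter_subset_right) ?_
  intro u hu
  exact ⟨e'.chart.map_source hu.2, by
    change e'.chart.symm (e'.chart u) ∈ e.chart.source
    rw [e'.chart.left_inv hu.2]; exact hu.1⟩

end AdaptedChart

section Prebundle

variable {π : E → M} {Fib : E → Type*} [∀ u, AddCommGroup (Fib u)] [∀ u, Module ℝ (Fib u)]
  {F₀ : Type*} [NormedAddCommGroup F₀] [NormedSpace ℝ F₀]

open Classical in
/-- The local trivialization of a family of vector spaces over `E` that an adapted chart gives,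
if the chart yields coordinates `L` on each fibre. -/
noncomputable def pretriv (e : AdaptedChart m n π)
    (L : ∀ u, u ∈ e.chart.source → (Fib u ≃ₗ[ℝ] F₀)) :
    Bundle.Pretrivialization F₀ (Bundle.TotalSpace.proj : Bundle.TotalSpace F₀ Fib → E) where
  toFun z := (z.1, if h : z.1 ∈ e.chart.source then L z.1 h z.2 else 0)
  invFun w := ⟨w.1, if h : w.1 ∈ e.chart.source then (L w.1 h).symm w.2 else 0⟩
  source := Bundle.TotalSpace.proj ⁻¹' e.chart.source
  target := e.chart.source ×ˢ univ
  map_source' z hz := ⟨hz, mem_univ _⟩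
  map_target' w hw := hw.1
  left_inv' := by
    rintro ⟨u, ξ⟩ hz
    have hu : u ∈ e.chart.source := hz
    simp [hu]
  right_inv' := by
    rintro ⟨u, p⟩ hw
    have hu : u ∈ e.chart.source := hw.1
    simp [hu]
  open_target := e.chart.open_source.prod isOpen_univ
  baseSet := e.chart.source
  open_baseSet := e.chart.open_source
  source_eq := rfl
  target_eq := rfl
  proj_toFun _ _ := rfl

theorem pretriv_apply (e : AdaptedChart m n π)
    (L : ∀ u, u ∈ e.chart.source → (Fib u ≃ₗ[ℝ] F₀)) (u : E) (hu : u ∈ e.chart.source)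
    (ξ : Fib u) : pretriv e L ⟨u, ξ⟩ = (u, L u hu ξ) := by
  change (u, _) = _
  simp [hu]

theorem pretriv_symm (e : AdaptedChart m n π)
    (L : ∀ u, u ∈ e.chart.source → (Fib u ≃ₗ[ℝ] F₀)) (u : E) (hu : u ∈ e.chart.source)
    (p : F₀) : (pretriv e L).symm u p = (L u hu).symm p := by
  have h := (pretriv e L).apply_mk_symm (b := u) hu p
  rw [pretriv_apply e L u hu] at h
  rw [LinearEquiv.eq_symm_apply]
  exact congrArg Prod.snd h

variable (m n π) in
/-- An adapted chart around a point. -/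
noncomputable def adaptedChartAt [IsManifold (𝓡 m) ∞ M] [IsSmoothFiberBundle m n π]
    (u : E) : AdaptedChart m n π :=
  Classical.choose (exists_adaptedChart π u)

theorem mem_adaptedChartAt [IsManifold (𝓡 m) ∞ M] [IsSmoothFiberBundle m n π]
    (u : E) : u ∈ (adaptedChartAt m n π u).chart.source :=
  Classical.choose_spec (exists_adaptedChart π u)

theorem exists_smooth_coordChange
    (L : ∀ (e : AdaptedChart m n π) u, u ∈ e.chart.source → (Fib u ≃ₗ[ℝ] F₀))
    (τ : (AdaptedModel m n →L[ℝ] AdaptedModel m n) → (F₀ →L[ℝ] F₀))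
    (hτ : ContDiff ℝ ∞ τ)
    (hL : ∀ (e e' : AdaptedChart m n π) u (hu : u ∈ e.chart.source) (hu' : u ∈ e'.chart.source) p,
      τ (AdaptedChart.jacobian e e' u) p = L e' u hu' ((L e u hu).symm p))
    (e e' : AdaptedChart m n π) :
    ∃ f : E → F₀ →L[ℝ] F₀, ContMDiffOn (𝓡 (m + n)) 𝓘(ℝ, F₀ →L[ℝ] F₀) ∞ f
      ((pretriv e (L e)).baseSet ∩ (pretriv e' (L e')).baseSet) ∧
      ∀ b ∈ (pretriv e (L e)).baseSet ∩ (pretriv e' (L e')).baseSet, ∀ p : F₀,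
        f b p = (pretriv e' (L e') ⟨b, (pretriv e (L e)).symm b p⟩).2 := by
  refine ⟨fun u => τ (AdaptedChart.jacobian e e' u), ?_, ?_⟩
  · exact hτ.contMDiff.comp_contMDiffOn (AdaptedChart.contMDiffOn_jacobian e e')
  · intro u hu p
    rw [pretriv_apply e' (L e') u hu.2, pretriv_symm e (L e) u hu.1]
    exact hL e e' u hu.1 hu.2 p

/-- The vector bundle structure on a family of vector spaces over `E` with coordinates `L` on the
fibres for each adapted chart, which change smoothly. The local trivializations are those of
all adapted charts. -/
@[reducible] noncomputable def adaptedPrebundle [IsManifold (𝓡 m) ∞ M]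
    [IsSmoothFiberBundle m n π] [∀ u, TopologicalSpace (Fib u)]
    (L : ∀ (e : AdaptedChart m n π) u, u ∈ e.chart.source → (Fib u ≃ₗ[ℝ] F₀))
    (τ : (AdaptedModel m n →L[ℝ] AdaptedModel m n) → (F₀ →L[ℝ] F₀))
    (hτ : ContDiff ℝ ∞ τ)
    (hL : ∀ (e e' : AdaptedChart m n π) u (hu : u ∈ e.chart.source) (hu' : u ∈ e'.chart.source) p,
      τ (AdaptedChart.jacobian e e' u) p = L e' u hu' ((L e u hu).symm p))
    (hind : ∀ u, Topology.IsInducing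
      (L (adaptedChartAt m n π u) u (mem_adaptedChartAt u))) :
    VectorPrebundle ℝ F₀ Fib where
  pretrivializationAtlas := range fun e : AdaptedChart m n π => pretriv e (L e)
  pretrivialization_linear' := by
    rintro _ ⟨e, rfl⟩
    refine ⟨fun u hu => ⟨fun ξ ζ => ?_, fun c ξ => ?_⟩⟩ <;>
      simp only [pretriv_apply e (L e) u hu, map_add, map_smul]
  pretrivializationAt u := pretriv (adaptedChartAt m n π u) (L _)
  mem_base_pretrivializationAt u := mem_adaptedChartAt u
  pretrivialization_mem_atlas u := ⟨_, rfl⟩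
  exists_coordChange := by
    rintro _ ⟨e, rfl⟩ _ ⟨e', rfl⟩
    obtain ⟨f, hf, hf'⟩ := exists_smooth_coordChange L τ hτ hL e e'
    exact ⟨f, hf.continuousOn, hf'⟩
  totalSpaceMk_isInducing := by
    intro u
    have h : (pretriv (adaptedChartAt m n π u) (L _) ∘ Bundle.TotalSpace.mk u : Fib u → E × F₀) =
        Prod.mk u ∘ L (adaptedChartAt m n π u) u (mem_adaptedChartAt u) := by
      ext1 ξ
      exact pretriv_apply _ _ u (mem_adaptedChartAt u) ξ
    rw [h]
    exact (isInducing_prodMkRight u).comp (hind u)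

theorem adaptedPrebundle_isContMDiff [IsManifold (𝓡 m) ∞ M]
    [IsSmoothFiberBundle m n π] [∀ u, TopologicalSpace (Fib u)]
    (L : ∀ (e : AdaptedChart m n π) u, u ∈ e.chart.source → (Fib u ≃ₗ[ℝ] F₀))
    (τ : (AdaptedModel m n →L[ℝ] AdaptedModel m n) → (F₀ →L[ℝ] F₀))
    (hτ : ContDiff ℝ ∞ τ)
    (hL : ∀ (e e' : AdaptedChart m n π) u (hu : u ∈ e.chart.source) (hu' : u ∈ e'.chart.source) p,
      τ (AdaptedChart.jacobian e e' u) p = L e' u hu' ((L e u hu).symm p))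
    (hind : ∀ u, Topology.IsInducing
      (L (adaptedChartAt m n π u) u (mem_adaptedChartAt u))) :
    (adaptedPrebundle L τ hτ hL hind).IsContMDiff (𝓡 (m + n)) ∞ where
  exists_contMDiffCoordChange := by
    rintro _ ⟨e, rfl⟩ _ ⟨e', rfl⟩
    exact exists_smooth_coordChange L τ hτ hL e e'

end Prebundle

section DualBundles

variable (m n) (π : E → M)

/-- The fibre over `u` of the extended dual jet bundle `Λᵐ₂(T*E)`. -/
def ExtFiber (u : E) : Type := ExtForm m (vertical m n π u)

/-- The fibre over `u` of `J¹π* = Λᵐ₂(T*E) / Λᵐ₁(T*E)`. -/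
def RedFiber (u : E) : Type := RedForm m (vertical m n π u)

noncomputable instance (u : E) : AddCommGroup (ExtFiber m n π u) :=
  inferInstanceAs (AddCommGroup (ExtForm m (vertical m n π u)))
noncomputable instance (u : E) : Module ℝ (ExtFiber m n π u) :=
  inferInstanceAs (Module ℝ (ExtForm m (vertical m n π u)))
noncomputable instance (u : E) : AddCommGroup (RedFiber m n π u) :=
  inferInstanceAs (AddCommGroup (RedForm m (vertical m n π u)))
noncomputable instance (u : E) : Module ℝ (RedFiber m n π u) :=
  inferInstanceAs (Module ℝ (RedForm m (vertical m n π u)))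

/-- The extended dual jet bundle `Λᵐ₂(T*E)`: pairs of `u : E` and an `m`-form on `T_u E` that vanishes
on any two vertical vectors. -/
abbrev ExtendedDual : Type v := Bundle.TotalSpace (ℝ × (Fin m → Fin n → ℝ)) (ExtFiber m n π)
/-- The reduced dual jet bundle `J¹π* = Λᵐ₂(T*E) / Λᵐ₁(T*E)`. -/
abbrev ReducedDual : Type v := Bundle.TotalSpace (Fin m → Fin n → ℝ) (RedFiber m n π)

variable {m n π}

/-- Fibre coordinates `(p, p i α)` on `Λᵐ₂(T*E)`. -/
noncomputable def extFiberCoord [IsSmoothFiberBundle m n π] (e : AdaptedChart m n π) (u : E)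
    (hu : u ∈ e.chart.source) : ExtFiber m n π u ≃ₗ[ℝ] ℝ × (Fin m → Fin n → ℝ) :=
  extCoordEquiv (e.tangentEquiv u hu) (e.mem_vertical_iff u hu)

/-- Fibre coordinates `p i α` on `J¹π*`. -/
noncomputable def redFiberCoord [IsSmoothFiberBundle m n π] (e : AdaptedChart m n π) (u : E)
    (hu : u ∈ e.chart.source) : RedFiber m n π u ≃ₗ[ℝ] (Fin m → Fin n → ℝ) :=
  redCoordEquiv (e.tangentEquiv u hu) (e.mem_vertical_iff u hu)

variable [IsManifold (𝓡 m) ∞ M] [IsSmoothFiberBundle m n π]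

/-- The usual topology of a finite-dimensional vector space, through a linear isomorphism. -/
noncomputable instance (u : E) : TopologicalSpace (ExtFiber m n π u) :=
  TopologicalSpace.induced (extFiberCoord (adaptedChartAt m n π u) u (mem_adaptedChartAt u))
    inferInstance

noncomputable instance (u : E) : TopologicalSpace (RedFiber m n π u) :=
  TopologicalSpace.induced (redFiberCoord (adaptedChartAt m n π u) u (mem_adaptedChartAt u))
    inferInstance

variable (m n π)

/-- The bundle structure of `Λᵐ₂(T*E)`, with the natural coordinates `(x, u, p, p i α)`. -/
noncomputable def extPrebundle :
    VectorPrebundle ℝ (ℝ × (Fin m → Fin n → ℝ)) (ExtFiber m n π) :=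
  adaptedPrebundle extFiberCoord extTransition contDiff_extTransition
    (fun e e' u hu hu' q => by
      rw [AdaptedChart.jacobian_eq e e' u hu hu']
      exact extTransition_apply _ _ (e.mem_vertical_iff u hu) (e'.mem_vertical_iff u hu') q)
    (fun u => ⟨rfl⟩)

/-- The bundle structure of `J¹π*`, with the natural coordinates `(x, u, p i α)`. -/
noncomputable def redPrebundle :
    VectorPrebundle ℝ (Fin m → Fin n → ℝ) (RedFiber m n π) :=
  adaptedPrebundle redFiberCoord redTransition contDiff_redTransition
    (fun e e' u hu hu' q => by
      rw [AdaptedChart.jacobian_eq e e' u hu hu']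
      exact redTransition_apply _ _ (e.mem_vertical_iff u hu) (e'.mem_vertical_iff u hu') q)
    (fun u => ⟨rfl⟩)

instance : (extPrebundle m n π).IsContMDiff (𝓡 (m + n)) ∞ := by
  unfold extPrebundle; exact adaptedPrebundle_isContMDiff _ _ _ _ _

instance : (redPrebundle m n π).IsContMDiff (𝓡 (m + n)) ∞ := by
  unfold redPrebundle; exact adaptedPrebundle_isContMDiff _ _ _ _ _

noncomputable instance : TopologicalSpace (ExtendedDual m n π) :=
  (extPrebundle m n π).totalSpaceTopology
noncomputable instance : FiberBundle (ℝ × (Fin m → Fin n → ℝ)) (ExtFiber m n π) :=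
  (extPrebundle m n π).toFiberBundle
instance : VectorBundle ℝ (ℝ × (Fin m → Fin n → ℝ)) (ExtFiber m n π) :=
  (extPrebundle m n π).toVectorBundle
instance : ContMDiffVectorBundle ∞ (ℝ × (Fin m → Fin n → ℝ)) (ExtFiber m n π) (𝓡 (m + n)) :=
  (extPrebundle m n π).contMDiffVectorBundle (𝓡 (m + n))

noncomputable instance : TopologicalSpace (ReducedDual m n π) :=
  (redPrebundle m n π).totalSpaceTopology
noncomputable instance : FiberBundle (Fin m → Fin n → ℝ) (RedFiber m n π) :=
  (redPrebundle m n π).toFiberBundle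
instance : VectorBundle ℝ (Fin m → Fin n → ℝ) (RedFiber m n π) :=
  (redPrebundle m n π).toVectorBundle
instance : ContMDiffVectorBundle ∞ (Fin m → Fin n → ℝ) (RedFiber m n π) (𝓡 (m + n)) :=
  (redPrebundle m n π).contMDiffVectorBundle (𝓡 (m + n))

end DualBundles

end FiberBundles

section Manifolds

variable {V : Type*} [NormedAddCommGroup V] [NormedSpace ℝ V] {H : Type*} [TopologicalSpace H]
  (I : ModelWithCorners ℝ V H) {N : Type*} [TopologicalSpace N] [ChartedSpace H N]
  [IsManifold I ∞ N]
  {V' : Type*} [NormedAddCommGroup V'] [NormedSpace ℝ V'] {H' : Type*} [TopologicalSpace H']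
  (I' : ModelWithCorners ℝ V' H') {N' : Type*} [TopologicalSpace N'] [ChartedSpace H' N']
  [IsManifold I' ∞ N']

/-- `X` restricts to a smooth vector field on `U`. -/
def IsSmoothVectorFieldOn (X : ∀ p : N, TangentSpace I p) (U : Set N) : Prop :=
  ContMDiffOn I I.tangent ∞ (fun p => (⟨p, X p⟩ : TangentBundle I N)) U

variable (N) in
/-- A `k`-dimensional (smooth) distribution: a subbundle of rank `k` of the tangent bundle. -/
structure Distribution (k : ℕ) where
  space : ∀ p : N, Submodule ℝ (TangentSpace I p)
  finrank_space : ∀ p, Module.finrank ℝ (space p) = k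
  exists_frame : ∀ p₀ : N, ∃ U : Set N, IsOpen U ∧ p₀ ∈ U ∧
    ∃ Y : Fin k → ∀ p : N, TangentSpace I p, (∀ i, IsSmoothVectorFieldOn I (Y i) U) ∧
      ∀ p ∈ U, space p = Submodule.span ℝ (range fun i => Y i p)

variable {I} in
/-- Through every point there passes a `k`-dimensional integral manifold, here parametrized by an
open set of `ℝᵏ`. (The parametrization is an immersion since the distribution has rank `k`.) -/
def Distribution.IsIntegrable {k : ℕ} (D : Distribution I N k) : Prop :=
  ∀ p₀ : N, ∃ (W : Set (EuclideanSpace ℝ (Fin k))) (f : EuclideanSpace ℝ (Fin k) → N),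
    IsOpen W ∧ 0 ∈ W ∧ ContMDiffOn (𝓡 k) I ∞ f W ∧ f 0 = p₀ ∧
      ∀ y ∈ W, LinearMap.range (mfderiv (𝓡 k) I f y).toLinearMap = D.space (f y)

variable {I} in
/-- `D` is transverse to the fibres of `ρ`. -/
def Distribution.IsTransverse {k : ℕ} (D : Distribution I N k) (ρ : N → N') : Prop :=
  ∀ p : N, IsCompl (D.space p) (LinearMap.ker (mfderiv I I' ρ p).toLinearMap)

/-- `γ` restricts to a smooth local section of `ρ : N → N'` over the open set `U ⊆ N'`. -/
structure IsLocalSection (ρ : N → N') (U : Set N') (γ : N' → N) : Prop where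
  isOpen : IsOpen U
  contMDiffOn : ContMDiffOn I' I ∞ γ U
  right_inv : ∀ x ∈ U, ρ (γ x) = x

variable {I} in
/-- `γ` is a local section of `ρ` and `T_{γ(x)} Im γ = D_{γ(x)}` for all `x ∈ U`; the tangent space
of the image of `γ` at `γ(x)` is the image of `T_x γ`. -/
structure Distribution.IsIntegralSection {k : ℕ} (D : Distribution I N k) (ρ : N → N')
    (U : Set N') (γ : N' → N) : Prop where
  isLocalSection : IsLocalSection I I' ρ U γ
  range_eq : ∀ x ∈ U, LinearMap.range (mfderiv I' I γ x).toLinearMap = D.space (γ x)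

variable (N) in
/-- `k`-vectors at all the points of `N`, a not necessarily smooth section of `Λᵏ(TN)`. -/
abbrev Multivectors (k : ℕ) : Type _ := ∀ p : N, ⋀[ℝ]^k (TangentSpace I p)

variable {I} in
/-- Locally `X = Y₁ ∧ … ∧ Yₖ` with smooth vector fields `Yᵢ`. In particular `X` is smooth. -/
def IsLocallyDecomposable {k : ℕ} (X : Multivectors I N k) : Prop :=
  ∀ p₀ : N, ∃ U : Set N, IsOpen U ∧ p₀ ∈ U ∧
    ∃ Y : Fin k → ∀ p : N, TangentSpace I p, (∀ i, IsSmoothVectorFieldOn I (Y i) U) ∧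
      ∀ p ∈ U, X p = exteriorPower.ιMulti ℝ k fun i => Y i p

variable {I} in
/-- The class `{X}` of multivector fields associated with `D`: the nowhere vanishing, locally
decomposable multivector fields that are sections of `Λᵏ D`. -/
def Distribution.multivectorClass {k : ℕ} (D : Distribution I N k) : Set (Multivectors I N k) :=
  {X | IsLocallyDecomposable X ∧ (∀ p, X p ≠ 0) ∧
    ∀ p, X p ∈ LinearMap.range (exteriorPower.map k (D.space p).subtype)}

variable {I I'} in
/-- The distributions `D` and `D'` are `s`-related: for every `X'` in the class of `D'` there is
an `X` in the class of `D`, and for every `X` in the class of `D` there is an `X'` in the class of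
`D'`, with `X' ∘ s = Λᵏ Ts ∘ X`. -/
def Distribution.IsRelated {k : ℕ} (D : Distribution I N k) (D' : Distribution I' N' k)
    (s : N → N') : Prop :=
  (∀ X' ∈ D'.multivectorClass, ∃ X ∈ D.multivectorClass,
    ∀ p, X' (s p) = exteriorPower.map k (mfderiv I I' s p).toLinearMap (X p)) ∧
  (∀ X ∈ D.multivectorClass, ∃ X' ∈ D'.multivectorClass,
    ∀ p, X' (s p) = exteriorPower.map k (mfderiv I I' s p).toLinearMap (X p))

variable (N) in
/-- `k`-forms at all the points of `N`, a not necessarily smooth differential form. -/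
abbrev Forms (k : ℕ) : Type _ := ∀ p : N, TangentSpace I p [⋀^Fin k]→L[ℝ] ℝ

variable {I} in
/-- Smoothness of a form, tested on smooth local vector fields. -/
def IsSmoothForm {k : ℕ} (θ : Forms I N k) : Prop :=
  ∀ (U : Set N) (Y : Fin k → ∀ p : N, TangentSpace I p), IsOpen U →
    (∀ i, IsSmoothVectorFieldOn I (Y i) U) → ContMDiffOn I 𝓘(ℝ, ℝ) ∞ (fun p => θ p fun i => Y i p) U

variable {I} in
/-- A smooth nowhere vanishing form (of degree `k = dim N`). -/
structure IsVolumeForm {k : ℕ} (θ : Forms I N k) : Prop where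
  smooth : IsSmoothForm θ
  ne_zero : ∀ p, θ p ≠ 0

/-- The pull-back `f^* θ`. -/
noncomputable def pullbackForm {k : ℕ} (f : N → N') (θ : Forms I' N' k) : Forms I N k :=
  fun p => (θ (f p)).compContinuousLinearMap (mfderiv I I' f p)

variable {I} in
/-- The contraction `i(X)θ`. -/
noncomputable def contractForm {k : ℕ} (X : ∀ p : N, TangentSpace I p) (θ : Forms I N (k + 1)) :
    Forms I N k := fun p =>
  { toAlternatingMap := (θ p).toAlternatingMap.curryLeft (X p)
    cont := (θ p).cont.comp (continuous_const.matrixVecCons continuous_id) }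

variable {I} in
/-- The exterior derivative of a form on a manifold, computed in the preferred chart at each point. -/
noncomputable def extDerivForm {k : ℕ} (θ : Forms I N k) : Forms I N (k + 1) := fun p =>
  ContinuousAlternatingMap.compContinuousLinearMap
    (extDeriv (fun y : V => (pullbackForm 𝓘(ℝ, V) I (extChartAt I p).symm θ y :
      V [⋀^Fin k]→L[ℝ] ℝ)) (extChartAt I p p))
    (mfderiv I 𝓘(ℝ, V) (extChartAt I p) p : TangentSpace I p →L[ℝ] V)

end Manifolds

section HamiltonJacobi

variable (m n : ℕ) {M : Type u} {E : Type v}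
  [TopologicalSpace M] [ChartedSpace (EuclideanSpace ℝ (Fin m)) M]
  [TopologicalSpace E] [ChartedSpace (EuclideanSpace ℝ (Fin (m + n))) E] (π : E → M)

/-- The models of the manifolds `Λᵐ₂(T*E)` and `J¹π*`. -/
noncomputable abbrev extModel : ModelWithCorners ℝ
    (EuclideanSpace ℝ (Fin (m + n)) × (ℝ × (Fin m → Fin n → ℝ)))
    (ModelProd (EuclideanSpace ℝ (Fin (m + n))) (ℝ × (Fin m → Fin n → ℝ))) :=
  (𝓡 (m + n)).prod 𝓘(ℝ, ℝ × (Fin m → Fin n → ℝ))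

noncomputable abbrev redModel : ModelWithCorners ℝ
    (EuclideanSpace ℝ (Fin (m + n)) × (Fin m → Fin n → ℝ))
    (ModelProd (EuclideanSpace ℝ (Fin (m + n))) (Fin m → Fin n → ℝ)) :=
  (𝓡 (m + n)).prod 𝓘(ℝ, Fin m → Fin n → ℝ)

variable {m n π} in
/-- The quotient map `μ : Λᵐ₂(T*E) → J¹π*`. -/
noncomputable def dualQuotient (z : ExtendedDual m n π) : ReducedDual m n π := ⟨z.1, RedForm.mk z.2⟩

variable {m n π} in
/-- The `m`-form on `T_u E` that an element of `Λᵐ₂(T_u^*E)` is. -/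
def ExtFiber.form {u : E} (ξ : ExtFiber m n π u) : TangentSpace (𝓡 (m + n)) u [⋀^Fin m]→L[ℝ] ℝ :=
  Subtype.val (show semibasic₂ m (vertical m n π u) from ξ)

variable [IsManifold (𝓡 m) ∞ M] [IsManifold (𝓡 (m + n)) ∞ E] [IsSmoothFiberBundle m n π]

/-- The tautological form `Θ`. -/
noncomputable def liouvilleForm : Forms (extModel m n) (ExtendedDual m n π) m := fun z =>
  z.2.form.compContinuousLinearMap
    (mfderiv (extModel m n) (𝓡 (m + n)) (Bundle.TotalSpace.proj : ExtendedDual m n π → E) z)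

/-- The canonical multisymplectic form `Ω = -dΘ`. -/
noncomputable def canonicalForm : Forms (extModel m n) (ExtendedDual m n π) (m + 1) :=
  fun z => -extDerivForm (liouvilleForm m n π) z

variable {π}

/-- `h` is a Hamiltonian section: a global section of `μ`. -/
structure IsHamiltonianSection (h : ReducedDual m n π → ExtendedDual m n π) : Prop where
  contMDiff : ContMDiff (redModel m n) (extModel m n) ∞ h
  right_inv : ∀ z, dualQuotient (h z) = z

/-- The Hamilton-Cartan form `Ω_h = h^* Ω`. -/
noncomputable def hamiltonCartanForm (h : ReducedDual m n π → ExtendedDual m n π) :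
    Forms (redModel m n) (ReducedDual m n π) (m + 1) :=
  pullbackForm (redModel m n) (extModel m n) h (canonicalForm m n π)

/-- The field equation `ψ^* i(X)Ω_h = 0` on `U`, for every vector field `X` on `J¹π*`. -/
def SolvesFieldEquation (h : ReducedDual m n π → ExtendedDual m n π) (U : Set M)
    (ψ : M → ReducedDual m n π) : Prop :=
  ∀ X : ∀ z : ReducedDual m n π, TangentSpace (redModel m n) z,
    IsSmoothVectorFieldOn (redModel m n) X univ →
      ∀ x ∈ U, pullbackForm (𝓡 m) (redModel m n) ψ
        (contractForm X (hamiltonCartanForm m n h)) x = 0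

variable (π) in
/-- The projection `J¹π* → M`. -/
def redProj (z : ReducedDual m n π) : M := π z.proj

/-- `Dh` solves the Hamiltonian problem: it is transverse to `J¹π* → M` and integrable, and its
integral sections solve the field equation. -/
structure SolvesHamiltonianProblem (h : ReducedDual m n π → ExtendedDual m n π)
    (Dh : Distribution (redModel m n) (ReducedDual m n π) m) : Prop where
  isTransverse : Dh.IsTransverse (𝓡 m) (redProj m n π)
  isIntegrable : Dh.IsIntegrable
  solves : ∀ (U : Set M) (ψ : M → ReducedDual m n π),
    Dh.IsIntegralSection (𝓡 m) (redProj m n π) U ψ → SolvesFieldEquation m n h U ψ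

/-- The generalized Hamiltonian Hamilton-Jacobi condition: if `γ` is an integral section of `D`,
then `s ∘ γ` is an integral section of `Dh`. -/
def GeneralizedHJCondition (Dh : Distribution (redModel m n) (ReducedDual m n π) m)
    (s : E → ReducedDual m n π) (D : Distribution (𝓡 (m + n)) E m) : Prop :=
  ∀ (U : Set M) (γ : M → E), D.IsIntegralSection (𝓡 m) π U γ →
    Dh.IsIntegralSection (𝓡 m) (redProj m n π) U (s ∘ γ)

end HamiltonJacobi

end HJ

open HJ

namespace HJ

set_option linter.unusedSectionVars false

/-! ### Exterior powers of subspaces. -/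

section LinearAlgebra

variable {T T' : Type*} [AddCommGroup T] [Module ℝ T] [AddCommGroup T'] [Module ℝ T']

/-! Both conditions are equivalent to the pointwise statement that `Ts` maps `D` at `p` onto `Dh` at
`s p`, for every `p : E`.

For the Hamilton-Jacobi condition, the chain rule shows that the image of `s ∘ γ` has tangent space
`Ts (D)` along an integral section `γ`. The pointwise statement therefore gives the condition at
once. Conversely, the condition yields the pointwise statement at each point through which an
integral section passes, and this is every point: an integral manifold of `D` is transverse to the
fibres of `π`, hence locally the image of a section by the inverse function theorem
(`Distribution.exists_isIntegralSection`). This is `forall_isIntegralSection_comp_iff`.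

For `s`-relatedness (`isRelated_iff`), a nonzero `m`-vector in `Λᵐ W` with `dim W = m` determines
`W`. If `X` and `Xh` are related, then `Xh (s p)` lies both in `Λᵐ (Ts D)` and in `Λᵐ Dh`, so these
spaces coincide. An `X` to start from exists because `M` is oriented by `η`: the `m`-vector field
dual to `η` lifts horizontally to `D` (`Distribution.multivectorClass_nonempty`). Conversely, let
`Ts` take `D` to `Dh`. The projection to `E` is a left inverse of `s`, so pushing `Xh ∘ s` down
gives the required `X`. In the other direction a field is needed on all of `J¹π*` and not just on
the image of `s`: project `X` to `M` and lift the result horizontally to `Dh`. On the image of `s`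
this is `Λᵐ Ts ∘ X`, since an element of `Λᵐ Dh` is the lift of its own projection. Smoothness of
the lifts is `Distribution.contMDiffAt_lift`. -/

theorem exteriorPower_map_map {T'' : Type*} [AddCommGroup T''] [Module ℝ T''] {k : ℕ}
    (f : T →ₗ[ℝ] T') (g : T' →ₗ[ℝ] T'') (w : ⋀[ℝ]^k T) :
    exteriorPower.map k g (exteriorPower.map k f w) = exteriorPower.map k (g ∘ₗ f) w := by
  rw [exteriorPower.map_comp]; rfl

/-- A linear map with nontrivial kernel kills the top exterior power. -/
theorem exteriorPower_map_eq_zero_of_not_injective {k : ℕ} [FiniteDimensional ℝ T]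
    (hT : Module.finrank ℝ T = k) (f : T →ₗ[ℝ] T') (hf : ¬ Function.Injective f) :
    exteriorPower.map k f = 0 := by
  apply exteriorPower.linearMap_ext
  ext1 a
  rw [LinearMap.compAlternatingMap_apply, exteriorPower.map_apply_ιMulti]
  -- If the `k` vectors `f (a i)` were independent, the rank of `f` would be at least `k = dim T`,
  -- which leaves no room for a kernel.
  refine AlternatingMap.map_linearDependent (exteriorPower.ιMulti ℝ k) _ fun hli => hf ?_
  have h2 : k ≤ Module.finrank ℝ (LinearMap.range f) := by
    have : LinearIndependent ℝ (fun i => (⟨f (a i), a i, rfl⟩ : LinearMap.range f)) :=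
      LinearIndependent.of_comp (LinearMap.range f).subtype hli
    simpa using this.fintype_card_le_finrank
  have h3 := f.finrank_range_add_finrank_ker
  rw [← LinearMap.ker_eq_bot, ← Submodule.finrank_eq_zero (R := ℝ)]
  omega

/-- A nonzero `k`-vector lies in `Λᵏ W` for at most one `k`-dimensional subspace `W`. -/
theorem eq_of_mem_range_exteriorPower_map {k : ℕ} [FiniteDimensional ℝ T] {W W' : Submodule ℝ T}
    (hW : Module.finrank ℝ W = k) (hW' : Module.finrank ℝ W' = k) {w : ⋀[ℝ]^k T} (hw : w ≠ 0)
    (h : w ∈ LinearMap.range (exteriorPower.map k W.subtype))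
    (h' : w ∈ LinearMap.range (exteriorPower.map k W'.subtype)) : W = W' := by
  refine Submodule.eq_of_le_of_finrank_eq (fun v hv => ?_) (hW.trans hW'.symm)
  by_contra hv'
  obtain ⟨φ, hφ, hφ'⟩ := W'.exists_le_ker_of_notMem hv'
  -- The projection along `v` onto `ker φ`. It fixes `W'` pointwise, so `Λᵏ f` fixes `w`; it kills
  -- `v ∈ W`, so `Λᵏ f` vanishes on `Λᵏ W` and kills `w`.
  let f : T →ₗ[ℝ] T := LinearMap.id - φ.smulRight ((φ v)⁻¹ • v)
  have hfW' : f ∘ₗ W'.subtype = W'.subtype := by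
    ext x
    have : φ x = 0 := hφ' x.2
    simp [f, this]
  have hfv : f v = 0 := by simp [f, smul_smul, hφ]
  have hv0 : v ≠ 0 := by rintro rfl; exact hφ (map_zero φ)
  have hf : ¬ Function.Injective (f ∘ₗ W.subtype) := fun hinj => hv0 <| by
    have : (⟨v, hv⟩ : W) = 0 := hinj (by simpa using hfv)
    exact congrArg Subtype.val this
  obtain ⟨a, rfl⟩ := h
  obtain ⟨b, hb⟩ := h'
  apply hw
  have h1 : exteriorPower.map k f (exteriorPower.map k W.subtype a) = 0 := by
    rw [exteriorPower_map_map, exteriorPower_map_eq_zero_of_not_injective hW _ hf]; rfl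
  rw [← hb, exteriorPower_map_map, hfW', hb] at h1
  exact h1

/-- A linear map is an isomorphism on every complement of its kernel of the dimension of the
target. -/
noncomputable def complEquiv [FiniteDimensional ℝ T] [FiniteDimensional ℝ T'] {W : Submodule ℝ T}
    {A : T →ₗ[ℝ] T'} (h : IsCompl W (LinearMap.ker A))
    (hd : Module.finrank ℝ W = Module.finrank ℝ T') : W ≃ₗ[ℝ] T' :=
  LinearEquiv.ofInjectiveOfFinrankEq (A ∘ₗ W.subtype) (by
    rw [← LinearMap.ker_eq_bot, LinearMap.ker_eq_bot']
    intro x hx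
    have : (x : T) ∈ W ⊓ LinearMap.ker A := ⟨x.2, hx⟩
    rw [h.inf_eq_bot] at this
    exact Subtype.ext this) hd

theorem range_exteriorPower_map_le {k : ℕ} {W : Submodule ℝ T} {W' : Submodule ℝ T'}
    (f : T →ₗ[ℝ] T') (hf : W.map f ≤ W') {w : ⋀[ℝ]^k T}
    (hw : w ∈ LinearMap.range (exteriorPower.map k W.subtype)) :
    exteriorPower.map k f w ∈ LinearMap.range (exteriorPower.map k W'.subtype) := by
  obtain ⟨a, rfl⟩ := hw
  refine ⟨exteriorPower.map k (f.restrict fun x hx => hf (Submodule.mem_map_of_mem hx)) a, ?_⟩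
  rw [exteriorPower_map_map, exteriorPower_map_map]
  rfl

/-- `Λᵏ f` is injective on `Λᵏ W` if `f` is injective on `W`. -/
theorem exteriorPower_map_injOn {k : ℕ} {W : Submodule ℝ T} (f : T →ₗ[ℝ] T')
    (hf : Function.Injective (f ∘ₗ W.subtype)) :
    Set.InjOn (exteriorPower.map k f) (LinearMap.range (exteriorPower.map k W.subtype)) := by
  rintro _ ⟨a, rfl⟩ _ ⟨b, rfl⟩ hab
  rw [exteriorPower_map_map, exteriorPower_map_map] at hab
  rw [exteriorPower.map_injective_field hf hab]

/-- Two alternating maps of top degree are proportional. -/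
theorem alternating_apply_smul_comm {k : ℕ} (b : Module.Basis (Fin k) ℝ T)
    (f : T [⋀^Fin k]→ₗ[ℝ] ℝ) (g : T [⋀^Fin k]→ₗ[ℝ] T') (v : Fin k → T) :
    f v • g b = f b • g v := by
  -- Both sides are alternating in `v`, so it suffices to compare them on injective reindexings of
  -- `b`. These are permutations, and `f` and `g` pick up the same sign.
  have h : (LinearMap.toSpanSingleton ℝ T' (g b)).compAlternatingMap f = f b • g := by
    refine b.ext_alternating fun σ hσ => ?_
    have hp := Finite.injective_iff_bijective.1 hσ
    have hf : f (fun i => b (σ i)) = _ := f.map_perm b (Equiv.ofBijective σ hp)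
    have hg : g (fun i => b (σ i)) = _ := g.map_perm b (Equiv.ofBijective σ hp)
    rw [LinearMap.compAlternatingMap_apply, AlternatingMap.smul_apply, hf, hg,
      LinearMap.toSpanSingleton_apply, smul_assoc, smul_comm (f b)]
  exact DFunLike.congr_fun h v

end LinearAlgebra

/-! ### Horizontal lifts to a transverse distribution. -/

section HorizontalLift

variable {V : Type*} [NormedAddCommGroup V] [NormedSpace ℝ V] [FiniteDimensional ℝ V]
  {H : Type*} [TopologicalSpace H]
  {I : ModelWithCorners ℝ V H} {N : Type*} [TopologicalSpace N] [ChartedSpace H N]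
  [IsManifold I ∞ N]
  {V' : Type*} [NormedAddCommGroup V'] [NormedSpace ℝ V'] [FiniteDimensional ℝ V']
  {H' : Type*} [TopologicalSpace H']
  {I' : ModelWithCorners ℝ V' H'} {N' : Type*} [TopologicalSpace N'] [ChartedSpace H' N']
  [IsManifold I' ∞ N']

/-- The isomorphism of a transverse distribution with the tangent spaces of the base. -/
noncomputable def Distribution.baseEquiv {k : ℕ} (D : Distribution I N k) {ρ : N → N'}
    (h : D.IsTransverse I' ρ) (hk : Module.finrank ℝ V' = k) (p : N) :
    D.space p ≃ₗ[ℝ] TangentSpace I' (ρ p) :=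
  haveI : FiniteDimensional ℝ (TangentSpace I p) := inferInstanceAs (FiniteDimensional ℝ V)
  haveI : FiniteDimensional ℝ (TangentSpace I' (ρ p)) := inferInstanceAs (FiniteDimensional ℝ V')
  complEquiv (h p) ((D.finrank_space p).trans hk.symm)

/-- The horizontal lift of tangent vectors of the base. -/
noncomputable def Distribution.lift {k : ℕ} (D : Distribution I N k) {ρ : N → N'}
    (h : D.IsTransverse I' ρ) (hk : Module.finrank ℝ V' = k) (p : N) :
    TangentSpace I' (ρ p) →ₗ[ℝ] TangentSpace I p :=
  (D.space p).subtype ∘ₗ (D.baseEquiv h hk p).symm.toLinearMap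

section
variable {k : ℕ} (D : Distribution I N k) {ρ : N → N'}
    (h : D.IsTransverse I' ρ) (hk : Module.finrank ℝ V' = k) (p : N)

theorem Distribution.lift_mem (v : TangentSpace I' (ρ p)) : D.lift h hk p v ∈ D.space p :=
  Subtype.property _

theorem Distribution.mfderiv_lift (v : TangentSpace I' (ρ p)) :
    mfderiv I I' ρ p (D.lift h hk p v) = v :=
  (D.baseEquiv h hk p).apply_symm_apply v

theorem Distribution.lift_mfderiv {w : TangentSpace I p} (hw : w ∈ D.space p) :
    D.lift h hk p (mfderiv I I' ρ p w) = w :=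
  congrArg Subtype.val ((D.baseEquiv h hk p).symm_apply_apply ⟨w, hw⟩)

end

/-- The horizontal lift of a smooth vector field along `ρ` is smooth. -/
theorem Distribution.contMDiffAt_lift {k : ℕ} (D : Distribution I N k) {ρ : N → N'}
    (h : D.IsTransverse I' ρ) (hk : Module.finrank ℝ V' = k) (hρ : ContMDiff I I' ∞ ρ)
    {X : ∀ p : N, TangentSpace I' (ρ p)} {p₀ : N}
    (hX : ContMDiffAt I I'.tangent ∞ (fun p => (⟨ρ p, X p⟩ : TangentBundle I' N')) p₀) :
    ContMDiffAt I I.tangent ∞ (fun p => (⟨p, D.lift h hk p (X p)⟩ : TangentBundle I N)) p₀ := by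
  obtain ⟨U, hU, hp₀, Y, hY, hspan⟩ := D.exists_frame p₀
  have hUn := hU.mem_nhds hp₀
  let e := trivializationAt V' (TangentSpace I') (ρ p₀)
  have hρY : ∀ i, ContMDiffAt I I'.tangent ∞
      (fun p => (⟨ρ p, mfderiv I I' ρ p (Y i p)⟩ : TangentBundle I' N')) p₀ := fun i =>
    ((hρ.contMDiff_tangentMap (m := ∞) le_rfl).contMDiffAt).comp p₀ ((hY i).contMDiffAt hUn)
  have hb : ∀ i, ContMDiffAt I 𝓘(ℝ, V') ∞ (fun p => (e ⟨ρ p, mfderiv I I' ρ p (Y i p)⟩).2) p₀ :=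
    fun i => (Bundle.contMDiffAt_totalSpace.1 (hρY i)).2
  have hbX : ContMDiffAt I 𝓘(ℝ, V') ∞ (fun p => (e ⟨ρ p, X p⟩).2) p₀ :=
    (Bundle.contMDiffAt_totalSpace.1 hX).2
  -- `B p` is the matrix of `Tρ` on `D`, in the frame `Y` of `D` and the trivialization `e` of the
  -- tangent bundle of the base. The coefficients of the lift in the frame are `B⁻¹` applied to `X`,
  -- which is smooth because inversion of operators is.
  let B : N → (Fin k → ℝ) →L[ℝ] V' := fun p =>
    ∑ i, (ContinuousLinearMap.proj i : (Fin k → ℝ) →L[ℝ] ℝ).smulRight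
      (e ⟨ρ p, mfderiv I I' ρ p (Y i p)⟩).2
  have hB : ContMDiffAt I 𝓘(ℝ, (Fin k → ℝ) →L[ℝ] V') ∞ B p₀ := by
    have : B = fun p => ∑ i, ContinuousLinearMap.smulRightL ℝ (Fin k → ℝ) V'
        (ContinuousLinearMap.proj i) (e ⟨ρ p, mfderiv I I' ρ p (Y i p)⟩).2 := rfl
    rw [this]
    exact contMDiffAt_finsetSum fun i _ =>
      (ContinuousLinearMap.contDiff _).contMDiff.contMDiffAt.comp p₀ (hb i)
  have hBe : ∀ p ∈ ρ ⁻¹' e.baseSet, ∀ c : Fin k → ℝ,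
      B p c = (e ⟨ρ p, mfderiv I I' ρ p (∑ i, c i • Y i p)⟩).2 := by
    intro p hp c
    have he : ∀ v : TangentSpace I' (ρ p), (e ⟨ρ p, v⟩).2 = e.linearMapAt ℝ (ρ p) v := fun v => by
      rw [Bundle.Trivialization.coe_linearMapAt_of_mem _ hp]
    simp only [B, he, map_sum, map_smul, sum_apply,
      ContinuousLinearMap.smulRight_apply, ContinuousLinearMap.proj_apply]
  have hinj : ∀ p ∈ ρ ⁻¹' e.baseSet, ∀ v w : TangentSpace I' (ρ p),
      (e ⟨ρ p, v⟩).2 = (e ⟨ρ p, w⟩).2 → v = w := by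
    intro p hp v w hvw
    apply (e.continuousLinearEquivAt ℝ (ρ p) hp).injective
    simpa only [Bundle.Trivialization.continuousLinearEquivAt_apply] using hvw
  have hp₀e : p₀ ∈ ρ ⁻¹' e.baseSet := FiberBundle.mem_baseSet_trivializationAt V' (TangentSpace I') (ρ p₀)
  -- Transversality enters here: every vector of the base has a lift in `D`, and the lift is a
  -- combination of the frame.
  have hsurj : Function.Surjective (B p₀) := by
    intro v'
    let v : TangentSpace I' (ρ p₀) := (e.continuousLinearEquivAt ℝ (ρ p₀) hp₀e).symm v'
    have hv := D.lift_mem h hk p₀ v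
    rw [hspan p₀ hp₀, Submodule.mem_span_range_iff_exists_fun] at hv
    obtain ⟨c, hc⟩ := hv
    refine ⟨c, ?_⟩
    rw [hBe p₀ hp₀e, hc, D.mfderiv_lift]
    exact (e.continuousLinearEquivAt ℝ (ρ p₀) hp₀e).apply_symm_apply v'
  have hbij : Function.Bijective (B p₀).toLinearMap :=
    ⟨(LinearMap.injective_iff_surjective_of_finrank_eq_finrank (by simp [hk])).2 hsurj, hsurj⟩
  let β : (Fin k → ℝ) ≃L[ℝ] V' :=
    (LinearEquiv.ofBijective (B p₀).toLinearMap hbij).toContinuousLinearEquiv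
  have hβ : (β : (Fin k → ℝ) →L[ℝ] V') = B p₀ := by ext1; rfl
  have hc : ContMDiffAt I 𝓘(ℝ, Fin k → ℝ) ∞
      (fun p => (B p).inverse (e ⟨ρ p, X p⟩).2) p₀ := by
    refine ContMDiffAt.clm_apply ?_ hbX
    have : ContDiffAt ℝ ∞ ContinuousLinearMap.inverse (B p₀) := hβ ▸ contDiffAt_map_inverse β
    exact this.contMDiffAt.comp p₀ hB
  -- `ContinuousLinearMap.inverse` is zero at operators that are not invertible, so the formula for
  -- the lift is valid only where `B p` is invertible, which is a neighbourhood of `p₀`.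
  have hev : ∀ᶠ p in 𝓝 p₀, B p ∈ range ((↑) : ((Fin k → ℝ) ≃L[ℝ] V') → (Fin k → ℝ) →L[ℝ] V') :=
    hB.continuousAt.eventually_mem (hβ ▸ β.nhds)
  have hsum : ContMDiffAt I I.tangent ∞ (fun p => (⟨p, ∑ i, (B p).inverse (e ⟨ρ p, X p⟩).2 i • Y i p⟩ :
      TangentBundle I N)) p₀ :=
    ContMDiffAt.sum_section fun i _ => ContMDiffAt.smul_section
      (contMDiffAt_pi_space.1 hc i) ((hY i).contMDiffAt hUn)
  refine hsum.congr_of_eventuallyEq ?_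
  filter_upwards [hev, hUn, hρ.continuous.continuousAt.preimage_mem_nhds
    (e.open_baseSet.mem_nhds hp₀e)] with p hp hpU hpe
  obtain ⟨β', hβ'⟩ := hp
  set c := (B p).inverse (e ⟨ρ p, X p⟩).2 with hcdef
  have hcX : B p c = (e ⟨ρ p, X p⟩).2 := by
    rw [hcdef, ← hβ', ContinuousLinearMap.inverse_equiv]
    exact β'.apply_symm_apply _
  rw [hBe p hpe] at hcX
  have hD : ∑ i, c i • Y i p ∈ D.space p := by
    rw [hspan p hpU, Submodule.mem_span_range_iff_exists_fun]
    exact ⟨c, rfl⟩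
  rw [← hinj p hpe _ _ hcX, D.lift_mfderiv h hk p hD]

end HorizontalLift

/-- Every tangent space unfolds to the model space `V`, so the base point may be replaced by an
equal one without transporting the vector. -/
theorem tangentBundle_mk_eq {V : Type*} [NormedAddCommGroup V] [NormedSpace ℝ V]
    {H : Type*} [TopologicalSpace H] {I : ModelWithCorners ℝ V H} {N : Type*} [TopologicalSpace N]
    [ChartedSpace H N] [IsManifold I ∞ N] {p q : N} (hpq : p = q) (v : V) :
    (⟨p, v⟩ : TangentBundle I N) = ⟨q, v⟩ := by
  subst hpq; rfl

/-! ### Integral sections and the tangent map of `s`. -/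

section IntegralSections

variable {V : Type*} [NormedAddCommGroup V] [NormedSpace ℝ V] [FiniteDimensional ℝ V]
  {H : Type*} [TopologicalSpace H]
  {I : ModelWithCorners ℝ V H} {N : Type*} [TopologicalSpace N] [ChartedSpace H N]
  [IsManifold I ∞ N]
  {V₁ : Type*} [NormedAddCommGroup V₁] [NormedSpace ℝ V₁] [FiniteDimensional ℝ V₁]
  {H₁ : Type*} [TopologicalSpace H₁]
  {I₁ : ModelWithCorners ℝ V₁ H₁} {N₁ : Type*} [TopologicalSpace N₁] [ChartedSpace H₁ N₁]
  [IsManifold I₁ ∞ N₁]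
  {k : ℕ} {M : Type*} [TopologicalSpace M] [ChartedSpace (EuclideanSpace ℝ (Fin k)) M]
  [IsManifold (𝓡 k) ∞ M]

/-- The derivative of a local section is a right inverse of the derivative of the projection. -/
theorem IsLocalSection.mfderiv_comp_apply {ρ : N → M} (hρ : ContMDiff I (𝓡 k) ∞ ρ) {U : Set M}
    {γ : M → N} (h : IsLocalSection I (𝓡 k) ρ U γ) {x : M} (hx : x ∈ U)
    (v : TangentSpace (𝓡 k) x) :
    (mfderiv I (𝓡 k) ρ (γ x) (mfderiv (𝓡 k) I γ x v) : EuclideanSpace ℝ (Fin k)) = v := by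
  have h1 : HasMFDerivAt (𝓡 k) (𝓡 k) (ρ ∘ γ) x _ :=
    HasMFDerivAt.comp x (hρ.mdifferentiable (by simp) (γ x)).hasMFDerivAt
      ((h.contMDiffOn.contMDiffAt (h.isOpen.mem_nhds hx)).mdifferentiableAt (by simp)).hasMFDerivAt
  have h2 := (hasMFDerivAt_id (I := 𝓡 k) x).congr_of_eventuallyEq (f₁ := ρ ∘ γ) (by
    filter_upwards [h.isOpen.mem_nhds hx] with y hy using h.right_inv y hy)
  exact DFunLike.congr_fun (hasMFDerivAt_unique h1 h2) v

/-- A local section tangent to a `k`-dimensional distribution is an integral section. -/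
theorem IsLocalSection.isIntegralSection {ρ : N → M} (hρ : ContMDiff I (𝓡 k) ∞ ρ) {U : Set M}
    {γ : M → N} (h : IsLocalSection I (𝓡 k) ρ U γ) (D : Distribution I N k)
    (hle : ∀ x ∈ U, LinearMap.range (mfderiv (𝓡 k) I γ x).toLinearMap ≤ D.space (γ x)) :
    D.IsIntegralSection (𝓡 k) ρ U γ := by
  refine ⟨h, fun x hx => ?_⟩
  have : FiniteDimensional ℝ (TangentSpace I (γ x)) := inferInstanceAs (FiniteDimensional ℝ V)
  refine Submodule.eq_of_le_of_finrank_eq (hle x hx) ?_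
  -- `Tρ` is a left inverse of `Tγ`, so the image of `Tγ` has dimension `k`, and the inclusion in
  -- `D` is an equality.
  have hinj : Function.Injective (mfderiv (𝓡 k) I γ x).toLinearMap := by
    intro v w hvw
    have h1 := h.mfderiv_comp_apply hρ hx v
    have h2 := h.mfderiv_comp_apply hρ hx w
    have h3 : mfderiv (𝓡 k) I γ x v = mfderiv (𝓡 k) I γ x w := hvw
    rw [h3, h2] at h1
    exact h1.symm
  rw [D.finrank_space, LinearMap.finrank_range_of_inj hinj]
  exact finrank_euclideanSpace_fin

/-- Through every point passes an integral section of an integrable transverse distribution. -/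
theorem Distribution.exists_isIntegralSection {ρ : N → M} (hρ : ContMDiff I (𝓡 k) ∞ ρ)
    (D : Distribution I N k) (hD : D.IsIntegrable) (hDt : D.IsTransverse (𝓡 k) ρ) (p₀ : N) :
    ∃ (U : Set M) (γ : M → N), D.IsIntegralSection (𝓡 k) ρ U γ ∧ ρ p₀ ∈ U ∧ γ (ρ p₀) = p₀ := by
  obtain ⟨W, f, hW, h0, hf, hfp, hrange⟩ := hD p₀
  let φ := chartAt (EuclideanSpace ℝ (Fin k)) (ρ p₀)
  have hφm : φ.MDifferentiable (𝓡 k) (𝓡 k) :=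
    ⟨(contMDiffOn_chart (n := ∞)).mdifferentiableOn (by simp),
      (contMDiffOn_chart_symm (n := ∞)).mdifferentiableOn (by simp)⟩
  -- The integral manifold `f`, projected to the base and read in the chart `φ`. It is a local
  -- diffeomorphism; reparametrizing `f` by its inverse turns the integral manifold into a section.
  let F : EuclideanSpace ℝ (Fin k) → EuclideanSpace ℝ (Fin k) := fun y => φ (ρ (f y))
  have hρf : ContMDiffOn (𝓡 k) (𝓡 k) ∞ (ρ ∘ f) W := hρ.comp_contMDiffOn hf
  let S : Set (EuclideanSpace ℝ (Fin k)) := W ∩ (ρ ∘ f) ⁻¹' φ.source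
  have hS : IsOpen S := hρf.continuousOn.isOpen_inter_preimage hW φ.open_source
  have h0S : (0 : EuclideanSpace ℝ (Fin k)) ∈ S := ⟨h0, by
    change ρ (f 0) ∈ φ.source
    rw [hfp]; exact mem_chart_source _ _⟩
  have hF : ContDiffOn ℝ ∞ F S := by
    rw [← contMDiffOn_iff_contDiffOn]
    exact (contMDiffOn_chart (I := 𝓡 k) (n := ∞) (x := ρ p₀)).comp (hρf.mono inter_subset_left)
      (fun y hy => hy.2)
  -- Invertibility is proved on all of `S` and not only at `0`, because the inverse of `F` has to be
  -- smooth on a whole neighbourhood.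
  have hFd : ∀ y ∈ S, ∃ A : EuclideanSpace ℝ (Fin k) ≃L[ℝ] EuclideanSpace ℝ (Fin k),
      HasFDerivAt F (A : EuclideanSpace ℝ (Fin k) →L[ℝ] EuclideanSpace ℝ (Fin k)) y := by
    intro y hy
    have hfd := ((hf.contMDiffAt (hW.mem_nhds hy.1)).mdifferentiableAt (by simp)).hasMFDerivAt
    have hd : HasMFDerivAt (𝓡 k) (𝓡 k) F y ((mfderiv (𝓡 k) (𝓡 k) φ (ρ (f y))).comp
        ((mfderiv I (𝓡 k) ρ (f y)).comp (mfderiv (𝓡 k) I f y))) :=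
      HasMFDerivAt.comp y (hφm.mdifferentiableAt hy.2).hasMFDerivAt
        (HasMFDerivAt.comp y (hρ.mdifferentiable (by simp) (f y)).hasMFDerivAt hfd)
    -- The range of `Tf` is the `k`-dimensional `D`, so rank-nullity leaves no kernel.
    have hfinj : Function.Injective (mfderiv (𝓡 k) I f y).toLinearMap := by
      have : FiniteDimensional ℝ (TangentSpace (𝓡 k) y) :=
        inferInstanceAs (FiniteDimensional ℝ (EuclideanSpace ℝ (Fin k)))
      rw [← LinearMap.ker_eq_bot]
      have h1 := (mfderiv (𝓡 k) I f y).toLinearMap.finrank_range_add_finrank_ker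
      rw [hrange y hy.1, D.finrank_space] at h1
      have h2 : Module.finrank ℝ (TangentSpace (𝓡 k) y) = k := finrank_euclideanSpace_fin
      rw [← Submodule.finrank_eq_zero (R := ℝ)]
      omega
    let B : EuclideanSpace ℝ (Fin k) →L[ℝ] EuclideanSpace ℝ (Fin k) :=
      (mfderiv (𝓡 k) (𝓡 k) φ (ρ (f y))).comp
        ((mfderiv I (𝓡 k) ρ (f y)).comp (mfderiv (𝓡 k) I f y))
    have hB : Function.Injective B.toLinearMap := by
      rw [← LinearMap.ker_eq_bot, LinearMap.ker_eq_bot']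
      intro v hv
      -- A vector killed by `B` has image under `Tf` that lies in `D` and is vertical, hence is zero
      -- by transversality.
      have h1 : mfderiv I (𝓡 k) ρ (f y) (mfderiv (𝓡 k) I f y v) = 0 :=
        hφm.mfderiv_injective hy.2 (by rw [map_zero]; exact hv)
      have h2 : mfderiv (𝓡 k) I f y v ∈
          D.space (f y) ⊓ LinearMap.ker (mfderiv I (𝓡 k) ρ (f y)).toLinearMap :=
        ⟨by rw [← hrange y hy.1]; exact ⟨v, rfl⟩, h1⟩
      rw [(hDt (f y)).inf_eq_bot] at h2
      exact hfinj (((Submodule.mem_bot ℝ).1 h2).trans (map_zero _).symm)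
    refine ⟨(LinearEquiv.ofInjectiveEndo B.toLinearMap hB).toContinuousLinearEquiv, ?_⟩
    exact hd.hasFDerivAt
  choose! A hA using hFd
  have hFat : ∀ y ∈ S, ContDiffAt ℝ ∞ F y := fun y hy => hF.contDiffAt (hS.mem_nhds hy)
  let R₀ := (hFat 0 h0S).toOpenPartialHomeomorph F (hA 0 h0S) (by simp)
  -- The local inverse is cut down to `S`, where `F` has invertible derivative and `ρ ∘ f` stays in
  -- the domain of `φ`.
  let R := R₀.restrOpen S hS
  have hRF : ∀ y, R y = F y := fun y => rfl
  have hRS : R.source ⊆ S := fun y hy => by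
    rw [OpenPartialHomeomorph.restrOpen_source] at hy; exact hy.2
  have h0R : (0 : EuclideanSpace ℝ (Fin k)) ∈ R.source := by
    rw [OpenPartialHomeomorph.restrOpen_source]
    exact ⟨(hFat 0 h0S).mem_toOpenPartialHomeomorph_source (hA 0 h0S) (by simp), h0S⟩
  have hRsymm : ∀ z ∈ R.target, ContDiffAt ℝ ∞ R.symm z := fun z hz =>
    R.contDiffAt_symm hz (hA _ (hRS (R.map_target hz))) (hFat _ (hRS (R.map_target hz)))
  let U : Set M := φ.source ∩ φ ⁻¹' R.target
  have hU : IsOpen U := φ.isOpen_inter_preimage R.open_target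
  let g : M → EuclideanSpace ℝ (Fin k) := fun x => R.symm (φ x)
  have hgS : ∀ x ∈ U, g x ∈ S := fun x hx => hRS (R.map_target hx.2)
  have hg : ContMDiffOn (𝓡 k) (𝓡 k) ∞ g U := fun x hx =>
    (ContMDiffAt.comp x (hRsymm _ hx.2).contMDiffAt
      ((contMDiffOn_chart (I := 𝓡 k) (n := ∞) (x := ρ p₀)).contMDiffAt
        (φ.open_source.mem_nhds hx.1))).contMDiffWithinAt
  have hsec : IsLocalSection I (𝓡 k) ρ U (f ∘ g) := by
    refine ⟨hU, hf.comp hg fun x hx => (hgS x hx).1, fun x hx => ?_⟩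
    have h1 : φ (ρ (f (g x))) = φ x := R.right_inv hx.2
    exact φ.injOn (hgS x hx).2 hx.1 h1
  have hF0 : F 0 = φ (ρ p₀) := by simp only [F, hfp]
  have hg0 : g (ρ p₀) = 0 := by
    change R.symm (φ (ρ p₀)) = 0
    rw [← hF0]; exact R.left_inv h0R
  refine ⟨U, f ∘ g, hsec.isIntegralSection hρ D fun x hx => ?_, ⟨mem_chart_source _ _, ?_⟩, ?_⟩
  · have h1 : HasMFDerivAt (𝓡 k) I (f ∘ g) x _ :=
      HasMFDerivAt.comp x
        ((hf.contMDiffAt (hW.mem_nhds (hgS x hx).1)).mdifferentiableAt (by simp)).hasMFDerivAt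
        ((hg.contMDiffAt (hU.mem_nhds hx)).mdifferentiableAt (by simp)).hasMFDerivAt
    rw [h1.mfderiv]
    change _ ≤ D.space (f (g x))
    rw [← hrange _ (hgS x hx).1]
    rintro _ ⟨v, rfl⟩
    exact ⟨mfderiv (𝓡 k) (𝓡 k) g x v, rfl⟩
  · change φ (ρ p₀) ∈ R.target
    rw [← hF0]; exact R.map_source h0R
  · change f (g (ρ p₀)) = p₀
    rw [hg0, hfp]

/-- A map `s` over `M` takes the integral sections of `D` to integral sections of `D₁` if and only if
`Ts` takes `D` to `D₁`. -/
theorem forall_isIntegralSection_comp_iff {ρ : N → M} (hρ : ContMDiff I (𝓡 k) ∞ ρ)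
    {ρ₁ : N₁ → M} {s : N → N₁} (hs : ContMDiff I I₁ ∞ s)
    (hsρ : ∀ p, ρ₁ (s p) = ρ p) (D : Distribution I N k) (hD : D.IsIntegrable)
    (hDt : D.IsTransverse (𝓡 k) ρ) (D₁ : Distribution I₁ N₁ k) :
    (∀ (U : Set M) (γ : M → N), D.IsIntegralSection (𝓡 k) ρ U γ →
      D₁.IsIntegralSection (𝓡 k) ρ₁ U (s ∘ γ)) ↔
    ∀ p, (D.space p).map (mfderiv I I₁ s p).toLinearMap = D₁.space (s p) := by
  have key : ∀ (U : Set M) (γ : M → N), D.IsIntegralSection (𝓡 k) ρ U γ → ∀ x ∈ U,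
      LinearMap.range (mfderiv (𝓡 k) I₁ (s ∘ γ) x).toLinearMap =
        (D.space (γ x)).map (mfderiv I I₁ s (γ x)).toLinearMap := by
    intro U γ hγ x hx
    have h1 : HasMFDerivAt (𝓡 k) I₁ (s ∘ γ) x _ :=
      HasMFDerivAt.comp x (hs.mdifferentiable (by simp) (γ x)).hasMFDerivAt
        ((hγ.isLocalSection.contMDiffOn.contMDiffAt
          (hγ.isLocalSection.isOpen.mem_nhds hx)).mdifferentiableAt (by simp)).hasMFDerivAt
    rw [h1.mfderiv, ← hγ.range_eq x hx]
    exact LinearMap.range_comp _ _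
  constructor
  · intro h p
    obtain ⟨U, γ, hγ, hp, hγp⟩ := D.exists_isIntegralSection hρ hD hDt p
    have h1 := (h U γ hγ).range_eq _ hp
    rw [key U γ hγ _ hp] at h1
    -- The subspaces live in tangent spaces that depend on the point, so `γ (ρ p) = p` is applied by
    -- substitution for a variable `q`.
    have h2 : ∀ q, q = p → (D.space q).map (mfderiv I I₁ s q).toLinearMap = D₁.space (s q) →
        (D.space p).map (mfderiv I I₁ s p).toLinearMap = D₁.space (s p) := by
      rintro q rfl h3; exact h3
    exact h2 _ hγp h1
  · intro h U γ hγ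
    refine ⟨⟨hγ.isLocalSection.isOpen, hs.comp_contMDiffOn hγ.isLocalSection.contMDiffOn,
      fun x hx => ?_⟩, fun x hx => (key U γ hγ x hx).trans (h (γ x))⟩
    rw [Function.comp_apply, hsρ, hγ.isLocalSection.right_inv x hx]

end IntegralSections

/-- The exterior power of a surjection is surjective; here the surjection is `f` from `W` onto its
image. -/
theorem exists_exteriorPower_map_eq {T T' : Type*} [AddCommGroup T] [Module ℝ T] [AddCommGroup T']
    [Module ℝ T'] {k : ℕ} {W : Submodule ℝ T} {W' : Submodule ℝ T'} (f : T →ₗ[ℝ] T')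
    (hf : W.map f = W') {w' : ⋀[ℝ]^k T'}
    (hw' : w' ∈ LinearMap.range (exteriorPower.map k W'.subtype)) :
    ∃ w ∈ LinearMap.range (exteriorPower.map k W.subtype), exteriorPower.map k f w = w' := by
  subst hf
  obtain ⟨a, rfl⟩ := hw'
  obtain ⟨b, rfl⟩ := exteriorPower.map_surjective (f.submoduleMap_surjective W) a
  refine ⟨exteriorPower.map k W.subtype b, ⟨b, rfl⟩, ?_⟩
  rw [exteriorPower_map_map, exteriorPower_map_map]
  rfl

/-! ### Multivector fields of transverse distributions. -/

section Multivectors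

variable {V : Type*} [NormedAddCommGroup V] [NormedSpace ℝ V] [FiniteDimensional ℝ V]
  {H : Type*} [TopologicalSpace H]
  {I : ModelWithCorners ℝ V H} {N : Type*} [TopologicalSpace N] [ChartedSpace H N]
  [IsManifold I ∞ N]
  {V₁ : Type*} [NormedAddCommGroup V₁] [NormedSpace ℝ V₁] [FiniteDimensional ℝ V₁]
  {H₁ : Type*} [TopologicalSpace H₁]
  {I₁ : ModelWithCorners ℝ V₁ H₁} {N₁ : Type*} [TopologicalSpace N₁] [ChartedSpace H₁ N₁]
  [IsManifold I₁ ∞ N₁]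
  {V' : Type*} [NormedAddCommGroup V'] [NormedSpace ℝ V'] [FiniteDimensional ℝ V']
  {H' : Type*} [TopologicalSpace H']
  {I' : ModelWithCorners ℝ V' H'} {N' : Type*} [TopologicalSpace N'] [ChartedSpace H' N']
  [IsManifold I' ∞ N'] {k : ℕ}

/-- The projection of a transverse distribution to the base is injective. -/
theorem Distribution.mfderiv_injective (D : Distribution I N k) {ρ : N → N'}
    (h : D.IsTransverse I' ρ) (hk : Module.finrank ℝ V' = k) (p : N) :
    Function.Injective ((mfderiv I I' ρ p).toLinearMap ∘ₗ (D.space p).subtype) :=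
  (D.baseEquiv h hk p).injective

theorem Distribution.lift_injective (D : Distribution I N k) {ρ : N → N'}
    (h : D.IsTransverse I' ρ) (hk : Module.finrank ℝ V' = k) (p : N) :
    Function.Injective (D.lift h hk p) :=
  (D.space p).injective_subtype.comp (D.baseEquiv h hk p).symm.injective

theorem Distribution.map_lift_mem (D : Distribution I N k) {ρ : N → N'}
    (h : D.IsTransverse I' ρ) (hk : Module.finrank ℝ V' = k) (p : N)
    (w : ⋀[ℝ]^k (TangentSpace I' (ρ p))) :
    exteriorPower.map k (D.lift h hk p) w ∈
      LinearMap.range (exteriorPower.map k (D.space p).subtype) :=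
  ⟨exteriorPower.map k (D.baseEquiv h hk p).symm.toLinearMap w, by
    rw [exteriorPower_map_map]; rfl⟩

/-- Lifting after projecting is the identity on `D`, hence on its exterior power. Thus an element of
`Λᵏ D` is determined by its projection. -/
theorem Distribution.map_lift_map_mfderiv (D : Distribution I N k) {ρ : N → N'}
    (h : D.IsTransverse I' ρ) (hk : Module.finrank ℝ V' = k) (p : N)
    {w : ⋀[ℝ]^k (TangentSpace I p)}
    (hw : w ∈ LinearMap.range (exteriorPower.map k (D.space p).subtype)) :
    exteriorPower.map k (D.lift h hk p) (exteriorPower.map k (mfderiv I I' ρ p).toLinearMap w) =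
      w := by
  obtain ⟨a, rfl⟩ := hw
  rw [exteriorPower_map_map, exteriorPower_map_map]
  congr 2
  ext x
  exact D.lift_mfderiv h hk p x.2

/-- A distribution that is transverse to a projection to an orientable manifold is orientable. -/
theorem Distribution.multivectorClass_nonempty (D : Distribution I N k) {ρ : N → N'}
    (h : D.IsTransverse I' ρ) (hk : Module.finrank ℝ V' = k) (hρ : ContMDiff I I' ∞ ρ)
    {η : Forms I' N' k} (hη : IsVolumeForm η) (hk0 : k ≠ 0) : D.multivectorClass.Nonempty := by
  -- Positive degree provides a first factor that can absorb the normalizing function; a wedge of no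
  -- vectors is always `1`.
  obtain ⟨k, rfl⟩ := Nat.exists_eq_succ_of_ne_zero hk0
  let b : Module.Basis (Fin (k + 1)) ℝ V' := Module.finBasisOfFinrankEq ℝ V' hk
  -- One basis of the model space serves at every point, with no claim of smoothness in `x`. This is
  -- harmless because the wedge of a basis divided by its `η`-volume does not depend on the basis.
  let bt : ∀ x : N', Module.Basis (Fin (k + 1)) ℝ (TangentSpace I' x) := fun _ => b
  have hη0 : ∀ (x : N') (c : Module.Basis (Fin (k + 1)) ℝ (TangentSpace I' x)), η x c ≠ 0 := by
    intro x c hc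
    refine hη.ne_zero x (ContinuousAlternatingMap.toAlternatingMap_injective ?_)
    rw [(η x).toAlternatingMap.eq_smul_basis_det c]
    have : (η x).toAlternatingMap c = 0 := hc
    rw [this, zero_smul]; rfl
  -- The linear functional on `k`-vectors induced by `η` is nonzero on the wedge of the basis.
  have hw0 : ∀ x : N', exteriorPower.ιMulti ℝ (k + 1) (bt x) ≠ 0 := by
    intro x hx
    have h1 := congrArg (exteriorPower.alternatingMapLinearEquiv (η x).toAlternatingMap) hx
    rw [exteriorPower.alternatingMapLinearEquiv_apply_ιMulti, map_zero] at h1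
    exact hη0 x (bt x) h1
  refine ⟨fun p => exteriorPower.map (k + 1) (D.lift h hk p)
    ((η (ρ p) (bt (ρ p)))⁻¹ • exteriorPower.ιMulti ℝ (k + 1) (bt (ρ p))), ?_, ?_, fun p =>
      D.map_lift_mem h hk p _⟩
  · intro p₀
    let e := trivializationAt V' (TangentSpace I') (ρ p₀)
    let L := e.localFrame b
    have hL : ∀ i, IsSmoothVectorFieldOn I' (L i) e.baseSet := fun i =>
      e.contMDiffOn_localFrame_baseSet ∞ b i
    have hLb : ∀ x (hx : x ∈ e.baseSet), (fun i => L i x) = e.basisAt b hx := fun x hx =>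
      funext fun i => e.localFrame_apply_of_mem_baseSet b hx
    let g : N' → ℝ := fun x => (η x fun i => L i x)⁻¹
    have hg : ContMDiffOn I' 𝓘(ℝ, ℝ) ∞ g e.baseSet :=
      (hη.smooth e.baseSet L e.open_baseSet hL).inv₀ fun x hx => by
        rw [hLb x hx]; exact hη0 x _
    -- A smooth local frame whose first vector is rescaled so that `η` takes the value `1` on it.
    -- Its lifts are the decomposition sought.
    let W : Fin (k + 1) → ∀ x : N', TangentSpace I' x := Function.update L 0 fun x => g x • L 0 x
    have hW : ∀ i, IsSmoothVectorFieldOn I' (W i) e.baseSet := by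
      intro i
      by_cases hi : i = 0
      · subst hi
        simp only [W, Function.update_self]
        exact hg.smul_section (hL 0)
      · simp only [W, Function.update_of_ne hi]
        exact hL i
    refine ⟨ρ ⁻¹' e.baseSet, e.open_baseSet.preimage hρ.continuous,
      FiberBundle.mem_baseSet_trivializationAt V' (TangentSpace I') (ρ p₀),
      fun i p => D.lift h hk p (W i (ρ p)), fun i p hp => ?_, fun p hp => ?_⟩
    · refine (D.contMDiffAt_lift h hk hρ ?_).contMDiffWithinAt
      exact ((hW i).contMDiffAt (e.open_baseSet.mem_nhds hp)).comp p hρ.contMDiffAt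
    · have h1 := alternating_apply_smul_comm (bt (ρ p)) (η (ρ p)).toAlternatingMap
        (exteriorPower.ιMulti ℝ (k + 1)) (fun i => L i (ρ p))
      have h2 : η (ρ p) (fun i => L i (ρ p)) ≠ 0 := by
        rw [hLb _ hp]; exact hη0 _ _
      have h3 := hη0 _ (bt (ρ p))
      have h4 : (fun i => W i (ρ p)) = Function.update (fun i => L i (ρ p)) 0
          (g (ρ p) • L 0 (ρ p)) := by
        ext1 i
        by_cases hi : i = 0
        · subst hi; simp only [W, Function.update_self]
        · simp only [W, Function.update_of_ne hi]
      have h5 : exteriorPower.ιMulti ℝ (k + 1) (fun i => W i (ρ p)) =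
          g (ρ p) • exteriorPower.ιMulti ℝ (k + 1) (fun i => L i (ρ p)) := by
        rw [h4, AlternatingMap.map_update_smul, Function.update_eq_self]
      have h6 : exteriorPower.ιMulti ℝ (k + 1) (fun i => D.lift h hk p (W i (ρ p))) =
          exteriorPower.map (k + 1) (D.lift h hk p)
            (exteriorPower.ιMulti ℝ (k + 1) (fun i => W i (ρ p))) :=
        (exteriorPower.map_apply_ιMulti _ _).symm
      rw [h6, h5]
      refine congrArg (exteriorPower.map (k + 1) (D.lift h hk p)) ?_
      rw [inv_smul_eq_iff₀ h3, smul_comm, eq_inv_smul_iff₀ h2]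
      exact h1
  · intro p hp
    have h1 := exteriorPower.map_injective_field (D.lift_injective h hk p)
      (hp.trans (map_zero _).symm)
    exact smul_ne_zero (inv_ne_zero (hη0 _ _)) (hw0 _) h1

/-- Two distributions transverse to the projections to an oriented manifold `N'` are related by a
section `s` of `q` if and only if `Ts` takes the one to the other. -/
theorem isRelated_iff {q : N₁ → N} (hq : ContMDiff I₁ I ∞ q) {s : N → N₁} (hs : ContMDiff I I₁ ∞ s)
    (hqs : ∀ p, q (s p) = p) {ρ : N → N'} (hρ : ContMDiff I I' ∞ ρ) (D : Distribution I N k)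
    (hD : D.IsTransverse I' ρ) (D₁ : Distribution I₁ N₁ k) (hD₁ : D₁.IsTransverse I' (ρ ∘ q))
    (hk : Module.finrank ℝ V' = k) {η : Forms I' N' k} (hη : IsVolumeForm η) :
    D.IsRelated D₁ s ↔
      ∀ p, (D.space p).map (mfderiv I I₁ s p).toLinearMap = D₁.space (s p) := by
  have hqs' : ∀ p (v : V), (mfderiv I₁ I q (s p) (mfderiv I I₁ s p v) : V) = v := by
    intro p v
    have h1 : HasMFDerivAt I I (q ∘ s) p _ :=
      HasMFDerivAt.comp p (hq.mdifferentiable (by simp) (s p)).hasMFDerivAt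
        (hs.mdifferentiable (by simp) p).hasMFDerivAt
    have h2 : HasMFDerivAt I I (q ∘ s) p _ :=
      (hasMFDerivAt_id (I := I) p).congr_of_eventuallyEq (Filter.Eventually.of_forall hqs)
    exact DFunLike.congr_fun (hasMFDerivAt_unique h1 h2) v
  have hsinj : ∀ p, Function.Injective (mfderiv I I₁ s p).toLinearMap := fun p =>
    Function.LeftInverse.injective (g := fun w => (mfderiv I₁ I q (s p) w : V)) (hqs' p)
  have hfin : ∀ p, Module.finrank ℝ ((D.space p).map (mfderiv I I₁ s p).toLinearMap) = k :=
    fun p => (Submodule.equivMapOfInjective _ (hsinj p) _).finrank_eq.symm.trans (D.finrank_space p)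
  have hft : ∀ z : N₁, FiniteDimensional ℝ (TangentSpace I₁ z) := fun z =>
    inferInstanceAs (FiniteDimensional ℝ V₁)
  constructor
  · intro hR p
    rcases eq_or_ne k 0 with rfl | hk0
    · rw [Submodule.finrank_eq_zero.1 (hfin p), Submodule.finrank_eq_zero.1 (D₁.finrank_space _)]
    · obtain ⟨X, hX⟩ := D.multivectorClass_nonempty hD hk hρ hη hk0
      obtain ⟨X₁, hX₁, hXX₁⟩ := hR.2 X hX
      refine eq_of_mem_range_exteriorPower_map (hfin p) (D₁.finrank_space _) (hX₁.2.1 (s p)) ?_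
        (hX₁.2.2 (s p))
      rw [hXX₁]
      exact range_exteriorPower_map_le _ le_rfl (hX.2.2 p)
  · intro hsD
    have hρq : ∀ z, mfderiv I₁ I' (ρ ∘ q) z = (mfderiv I I' ρ (q z)).comp (mfderiv I₁ I q z) :=
      fun z => (HasMFDerivAt.comp z (hρ.mdifferentiable (by simp) (q z)).hasMFDerivAt
        (hq.mdifferentiable (by simp) z).hasMFDerivAt).mfderiv
    refine ⟨fun X₁ hX₁ => ?_, fun X hX => ?_⟩
    · let B : ∀ p, TangentSpace I₁ (s p) →ₗ[ℝ] TangentSpace I p := fun p =>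
        (mfderiv I₁ I q (s p)).toLinearMap
      have hB : ∀ p, B p ∘ₗ (mfderiv I I₁ s p).toLinearMap = LinearMap.id := fun p =>
        LinearMap.ext (hqs' p)
      -- Since `D₁` is `Ts (D)` along `s`, the value `X₁ (s p)` is the image of some `w` in `Λᵏ D`,
      -- and `B` recovers this `w`. Nonvanishing, tangency to `D` and the relation with `X₁` all
      -- follow.
      have hXD : ∀ p, ∃ w ∈ LinearMap.range (exteriorPower.map k (D.space p).subtype),
          exteriorPower.map k (B p) (X₁ (s p)) = w ∧
            X₁ (s p) = exteriorPower.map k (mfderiv I I₁ s p).toLinearMap w := by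
        intro p
        obtain ⟨w, hw, hw'⟩ := exists_exteriorPower_map_eq _ (hsD p) (hX₁.2.2 (s p))
        refine ⟨w, hw, ?_, hw'.symm⟩
        rw [← hw', exteriorPower_map_map, hB, exteriorPower.map_id]
        rfl
      refine ⟨fun p => exteriorPower.map k (B p) (X₁ (s p)), ⟨fun p₀ => ?_, fun p hp => ?_,
        fun p => ?_⟩, fun p => ?_⟩
      · obtain ⟨U, hU, hp₀, Y, hY, hYX⟩ := hX₁.1 (s p₀)
        refine ⟨s ⁻¹' U, hU.preimage hs.continuous, hp₀, fun i p => B p (Y i (s p)), fun i => ?_,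
          fun p hp => ?_⟩
        · have h1 : ContMDiffOn I I.tangent ∞ (fun p => (⟨q (s p),
              mfderiv I₁ I q (s p) (Y i (s p))⟩ : TangentBundle I N)) (s ⁻¹' U) :=
            (hq.contMDiff_tangentMap (m := ∞) le_rfl).comp_contMDiffOn
              ((hY i).comp hs.contMDiffOn fun p hp => hp)
          exact h1.congr fun p _ => tangentBundle_mk_eq (hqs p).symm _
        · change exteriorPower.map k (B p) (X₁ (s p)) = _
          rw [hYX (s p) hp, exteriorPower.map_apply_ιMulti]
          rfl
      · obtain ⟨w, -, h1, h2⟩ := hXD p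
        rw [h1.symm.trans hp, map_zero] at h2
        exact hX₁.2.1 (s p) h2
      · obtain ⟨w, hw, h1, -⟩ := hXD p
        exact Set.mem_of_eq_of_mem h1 hw
      · obtain ⟨w, -, h1, h2⟩ := hXD p
        exact h2.trans (congrArg _ h1.symm)
    · let A : ∀ z, TangentSpace I (q z) →ₗ[ℝ] TangentSpace I' (ρ (q z)) := fun z =>
        (mfderiv I I' ρ (q z)).toLinearMap
      refine ⟨fun z => exteriorPower.map k (D₁.lift hD₁ hk z) (exteriorPower.map k (A z) (X (q z))),
        ⟨fun z₀ => ?_, fun z hz => ?_, fun z => D₁.map_lift_mem hD₁ hk z _⟩, fun p => ?_⟩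
      · obtain ⟨U, hU, hz₀, Y, hY, hYX⟩ := hX.1 (q z₀)
        refine ⟨q ⁻¹' U, hU.preimage hq.continuous, hz₀,
          fun i z => D₁.lift hD₁ hk z (A z (Y i (q z))), fun i z hz => ?_, fun z hz => ?_⟩
        · refine (D₁.contMDiffAt_lift hD₁ hk (hρ.comp hq) ?_).contMDiffWithinAt
          have h1 : ContMDiffOn I I'.tangent ∞ (fun p => (⟨ρ p, mfderiv I I' ρ p (Y i p)⟩ :
              TangentBundle I' N')) U :=
            (hρ.contMDiff_tangentMap (m := ∞) le_rfl).comp_contMDiffOn (hY i)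
          exact (h1.contMDiffAt (hU.mem_nhds hz)).comp z hq.contMDiffAt
        · change exteriorPower.map k (D₁.lift hD₁ hk z)
            (exteriorPower.map k (A z) (X (q z))) = _
          rw [hYX (q z) hz, exteriorPower.map_apply_ιMulti]
          exact exteriorPower.map_apply_ιMulti _ _
      · have h1 := exteriorPower.map_injective_field (D₁.lift_injective hD₁ hk z)
          (hz.trans (map_zero _).symm)
        have h2 := exteriorPower_map_injOn (A z) (D.mfderiv_injective hD hk (q z)) (hX.2.2 (q z))
          (Submodule.zero_mem _) (h1.trans (map_zero _).symm)
        exact hX.2.1 (q z) h2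
      · have h1 : exteriorPower.map k (mfderiv I I₁ s p).toLinearMap (X p) ∈
            LinearMap.range (exteriorPower.map k (D₁.space (s p)).subtype) :=
          range_exteriorPower_map_le _ (hsD p).le (hX.2.2 p)
        have h2 := D₁.map_lift_map_mfderiv hD₁ hk (s p) h1
        -- `Λᵏ Ts (X p)` lies in `Λᵏ D₁`, so it is the lift of its own projection. It remains to see
        -- that this projection is that of `X p`, which follows from `ρ ∘ q ∘ s = ρ`.
        rw [← h2]
        refine congrArg (exteriorPower.map k (D₁.lift hD₁ hk (s p))) ?_
        -- The values of `X` at `q (s p)` and at `p` are compared in the common model `⋀[ℝ]^k V`.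
        have h3 : ∀ r, r = p → (X r : ⋀[ℝ]^k V) = X p := by rintro r rfl; rfl
        have h4 : (mfderiv I₁ I' (ρ ∘ q) (s p)).toLinearMap ∘ₗ (mfderiv I I₁ s p).toLinearMap =
            A (s p) := by
          ext v
          have h5 := congrArg (A (s p)) (hqs' p v)
          refine Eq.trans ?_ h5
          rw [hρq]
          rfl
        rw [exteriorPower_map_map, h4]
        exact congrArg (exteriorPower.map k (A (s p))) (h3 _ (hqs p))

end Multivectors

end HJ

/-! ### The Hamilton-Jacobi equivalence. -/

theorem mainTheorem7 {m n : ℕ} {M : Type*} {E : Type*}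
    [TopologicalSpace M] [T2Space M] [SecondCountableTopology M]
    [ChartedSpace (EuclideanSpace ℝ (Fin m)) M] [IsManifold (𝓡 m) ∞ M]
    [TopologicalSpace E] [T2Space E] [SecondCountableTopology E]
    [ChartedSpace (EuclideanSpace ℝ (Fin (m + n))) E] [IsManifold (𝓡 (m + n)) ∞ E]
    (π : E → M) [IsSmoothFiberBundle m n π]
    (η : Forms (𝓡 m) M m) (hη : IsVolumeForm η)
    (h : ReducedDual m n π → ExtendedDual m n π) (hh : IsHamiltonianSection m n h)
    (Dh : Distribution (redModel m n) (ReducedDual m n π) m)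
    (hDh : SolvesHamiltonianProblem m n h Dh)
    (s : E → ReducedDual m n π) (hs : ContMDiff (𝓡 (m + n)) (redModel m n) ∞ s)
    (hsec : ∀ u, (s u).proj = u)
    (D : Distribution (𝓡 (m + n)) E m) (hD : D.IsIntegrable) (hDt : D.IsTransverse (𝓡 m) π) :
    GeneralizedHJCondition m n Dh s D ↔ D.IsRelated Dh s := by

  have hk : Module.finrank ℝ (EuclideanSpace ℝ (Fin m)) = m := finrank_euclideanSpace_fin
  have hπ : ContMDiff (𝓡 (m + n)) (𝓡 m) ∞ π := IsSmoothFiberBundle.contMDiff π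
  have hq : ContMDiff (redModel m n) (𝓡 (m + n)) ∞
      (Bundle.TotalSpace.proj : ReducedDual m n π → E) := Bundle.contMDiff_proj _
  -- The two equivalences meet in the pointwise condition on `Ts`. The projection `redProj` unfolds
  -- to `π` after the bundle projection, which is the form of transversality that `isRelated_iff`
  -- takes.
  exact (forall_isIntegralSection_comp_iff hπ hs (fun u => congrArg π (hsec u)) D hD hDt Dh).trans
    (isRelated_iff hq hs hsec hπ D hDt Dh hDh.isTransverse hk hη).symm
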